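/- Let $P\in\mathbb{C}[z_1,z_2]$ be irreducible of total degree $d\ge 2$, and suppose that the curve $A=\{P=0\}\subset\mathbb{C}^2$ has $d$ linear asymptotes $z_2=\lambda_kz_1+c_k$, $k=1,\dots,d$, with $\lambda_1,\dots,\lambda_d$ distinct and nonzero (equivalently, the degree-$d$ homogeneous part of $P$ is $C\prod_{k}(z_2-\lambda_kz_1)$ with $C\neq 0$ and distinct nonzero $\lambda_k$). Here a line $z_2=\lambda z_1+c$ is a linear asymptote of $A$ if the distance from a point $z$ of the line to the part of $A$ lying on the complex line through $z$ orthogonal to it tends to $0$ as $|z|\to\infty$. Let $\mathbb{C}[A]=\mathbb{C}[z_1,z_2]/(P)$; the degree of an element of $\mathbb{C}[A]$ is the least degree of a polynomial representing it. Put $\mathbf v_k=\prod_{j\ne k}\frac{z_2-\lambda_jz_1}{\lambda_k-\lambda_j}$. For compact $K\subset A$ let $\|p\|_K=\sup_K|p|$. For a class $\mathcal N\subset\mathbb{C}[A]$ with unbounded set of degrees $\deg(\mathcal N)$ let $T_n(K,\mathcal N)=\inf\{\|p\|_K: p\in\mathcal N,\ \deg p=n\}^{1/n}$ for $n\in\deg(\mathcal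 N)$, and $T(K,\mathcal N)=\lim_{n\to\infty,\,n\in\deg(\mathcal N)}T_n(K,\mathcal N)$ if the limit exists. Let $T(K,\lambda_k)=T(K,\mathcal M(\mathbf v_k))$, where $\mathcal M(\mathbf v_k)$ is the set of all $\mathbf v_k^n+r$ with $n\in\mathbb{N}$ and $r$ of degree strictly less than $\deg \mathbf v_k^n$. Let $\mathcal S$ be the basis of $\mathbb{C}[A]$ formed by the monomials $z_1^az_2^b$ with $b\le d-1$, ordered by increasing degree and, within one degree, by increasing power of $z_2$. For $0\le k\le d-1$ let $\mathcal Z(k)$ be the set of all $z_2^kz_1^n+r$ with $n\in\mathbb{N}$ and $r$ a linear combination of elements of $\mathcal S$ preceding $z_2^kz_1^n$. Let $\mathcal C$ be the basis of $\mathbb{C}[A]$ formed by all monomials of degree at most $d-2$ (ordered as in $\mathcal S$), followed, for $n=d-1,d,\dots$, by the elements $z_1^r\mathbf v_1^q,\dots,z_1^r\mathbf v_d^q$ of degree $n=q(d-1)+r$, $0\le r<d-1$. For a basis $\mathcal B=\{\mathbf b_j\}_{j\ge1}$ listed by nondecreasing degree let $V_n=\sup\{|\det[\mathbf b_j(\zeta_k)]_{j,k=1}^n|:\zeta_1,\dots,\zeta_n\in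 K\}$, let $m_n$ be the number of $\mathbf b_j$ of degree at most $n$, let $l_n=\sum_{j\le m_n}\deg\mathbf b_j$, and let $d_{\mathcal B}(K)=\limsup_{n\to\infty}V_{m_n}^{1/l_n}$. **Theorem.** Let $K\subset A$ be compact. The limits $T(K,\lambda_k)$, $k=1,\dots,d$, exist. Suppose the directions are labelled so that $T(K,\lambda_1)\ge T(K,\lambda_2)\ge\dots\ge T(K,\lambda_d)$. Then the limits $T(K,\mathcal Z(k-1))$, $k=1,\dots,d$, exist, $$\Bigl(\prod_{k=1}^dT(K,\mathcal Z(k-1))\Bigr)^{1/d}=d_{\mathcal S}(K)=d_{\mathcal C}(K)=\Bigl(\prod_{k=1}^dT(K,\lambda_k)\Bigr)^{1/d},$$ and $T(K,\mathcal Z(k-1))=T(K,\lambda_k)$ for each $k\in\{1,\dots,d\}$. -/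

import Mathlib

open Filter Topology

noncomputable section

namespace AlgCurve

/-- The plane algebraic curve `{P = 0}` in `ℂ²`; the coordinates `z₁, z₂` have indices `0, 1`. -/
def curve (P : MvPolynomial (Fin 2) ℂ) : Set (Fin 2 → ℂ) :=
  {z | MvPolynomial.eval z P = 0}

/-- The complex line `z₂ = lam * z₁ + c` is a linear asymptote of `A`: as the point
`z = (t, lam * t + c)` of the line goes to infinity, the distance from `z` to the part of `A` on the
complex line through `z` orthogonal to the given line tends to `0`. (The direction of the line is
`(1, lam)`, so orthogonality of `w - z` to it is `(w₁ - z₁) + conj lam * (w₂ - z₂) = 0`.) -/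
def IsLinearAsymptote (A : Set (Fin 2 → ℂ)) (lam c : ℂ) : Prop :=
  ∀ ε : ℝ, 0 < ε → ∃ R : ℝ, ∀ t : ℂ, R < ‖t‖ →
    ∃ w ∈ A, (w 0 - t) + (starRingEnd ℂ) lam * (w 1 - (lam * t + c)) = 0 ∧
      ‖w - ![t, lam * t + c]‖ < ε

/-- The coordinate ring `ℂ[A] = ℂ[z₁, z₂] / (P)`. -/
abbrev CoordRing (P : MvPolynomial (Fin 2) ℂ) : Type :=
  MvPolynomial (Fin 2) ℂ ⧸ Ideal.span {P}

variable {P : MvPolynomial (Fin 2) ℂ}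

/-- The class in `ℂ[A]` of a polynomial. -/
def toRing (P : MvPolynomial (Fin 2) ℂ) : MvPolynomial (Fin 2) ℂ →+* CoordRing P :=
  Ideal.Quotient.mk (Ideal.span {P})

/-- The value of an element of `ℂ[A]` at a point of the curve. -/
def evalAt (z : curve P) : CoordRing P →+* ℂ :=
  Ideal.Quotient.lift (Ideal.span {P}) (MvPolynomial.eval z.1) (by
    intro a ha
    obtain ⟨b, rfl⟩ := Ideal.mem_span_singleton.mp ha
    have hz : MvPolynomial.eval z.1 P = 0 := z.2
    simp [hz])

/-- The degree of an element of `ℂ[A]`: the least total degree of a polynomial representing it. -/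
def deg (f : CoordRing P) : ℕ :=
  sInf {n | ∃ p : MvPolynomial (Fin 2) ℂ, toRing P p = f ∧ p.totalDegree = n}

/-- `r` has degree strictly less than `n`, where the zero polynomial has degree `-∞`. -/
def IsLot (r : CoordRing P) (n : ℕ) : Prop := r = 0 ∨ deg r < n

/-- The sup norm `‖p‖_K`. -/
def normOn (K : Set (curve P)) (p : CoordRing P) : ℝ :=
  sSup ((fun z => ‖evalAt z p‖) '' K)

/-! Chebyshev constants of a class `N` of polynomials. -/

/-- `T_n(K, N) = inf {‖p‖_K : p ∈ N, deg p = n} ^ (1 / n)`. -/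
def chebN (K : Set (curve P)) (N : Set (CoordRing P)) (n : ℕ) : ℝ :=
  (sInf (normOn K '' {p | p ∈ N ∧ deg p = n})) ^ (1 / (n : ℝ))

/-- The filter `n → ∞`, `n ∈ deg(N)`. -/
def degFilter (N : Set (CoordRing P)) : Filter ℕ := atTop ⊓ 𝓟 (deg '' N)

/-- The upper Chebyshev constant: the limsup of `T_n(K, N)` as `n → ∞` in `deg(N)`. It is the value
of the Chebyshev constant `T(K, N)` when the limit exists, see `HasCheb`. -/
def cheb (K : Set (curve P)) (N : Set (CoordRing P)) : ℝ :=
  limsup (chebN K N) (degFilter N)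

/-- The limit `lim T_n(K, N)` (as `n → ∞` in `deg(N)`) defining `T(K, N)` exists; `deg(N)` has to be
unbounded for the limit to make sense. -/
def HasCheb (K : Set (curve P)) (N : Set (CoordRing P)) : Prop :=
  (degFilter N).NeBot ∧ Tendsto (chebN K N) (degFilter N) (𝓝 (cheb K N))

/-- The class `M(Q) = {Q ^ n + lower order terms}`. -/
def monicClass (Q : CoordRing P) : Set (CoordRing P) :=
  {p | ∃ (n : ℕ) (r : CoordRing P), IsLot r (deg (Q ^ n)) ∧ p = Q ^ n + r}

/-- The coordinate function `z₁` in `ℂ[A]`. -/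
def z₁ (P : MvPolynomial (Fin 2) ℂ) : CoordRing P := toRing P (MvPolynomial.X 0)

/-- The coordinate function `z₂` in `ℂ[A]`. -/
def z₂ (P : MvPolynomial (Fin 2) ℂ) : CoordRing P := toRing P (MvPolynomial.X 1)

/-- The directional polynomial `v_k = ∏_{j ≠ k} (z₂ - lam_j z₁) / (lam_k - lam_j)` in `ℂ[A]`. -/
def dirPoly (P : MvPolynomial (Fin 2) ℂ) {d : ℕ} (lam : Fin d → ℂ) (k : Fin d) : CoordRing P :=
  toRing P (∏ j ∈ Finset.univ.erase k,
    MvPolynomial.C (lam k - lam j)⁻¹ *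
      (MvPolynomial.X 1 - MvPolynomial.C (lam j) * MvPolynomial.X 0))

/-- The directional Chebyshev constant `T(K, lam_k) = T(K, M(v_k))`. -/
def dirCheb {d : ℕ} (K : Set (curve P)) (lam : Fin d → ℂ) (k : Fin d) : ℝ :=
  cheb K (monicClass (dirPoly P lam k))

/-! Ordered bases. Both bases below have `min (n + 1) d` elements of degree `n`, and are listed by
increasing degree `n` and, within one degree, by increasing `k = 0, 1, …, min (n + 1) d - 1`. -/

/-- The successor of `(n, k)` in that listing. -/
def nextIndex (d : ℕ) (x : ℕ × ℕ) : ℕ × ℕ :=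
  if x.2 + 1 < min (x.1 + 1) d then (x.1, x.2 + 1) else (x.1 + 1, 0)

/-- The pair `(n, k)` at position `j` of the listing `(0, 0), (1, 0), (1, 1), (2, 0), …`. -/
def gridIndex (d j : ℕ) : ℕ × ℕ := (nextIndex d)^[j] (0, 0)

/-- The grevlex ordered monomial basis `S`: at the position `(n, k)` it has `z₁ ^ (n - k) * z₂ ^ k`
(where `k ≤ n` and `k < d`). -/
def monBasis (P : MvPolynomial (Fin 2) ℂ) (d j : ℕ) : CoordRing P :=
  z₁ P ^ ((gridIndex d j).1 - (gridIndex d j).2) * z₂ P ^ (gridIndex d j).2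

/-- The directional basis `C`: monomials in degrees `n ≤ d - 2`, and in degrees `n ≥ d - 1` it has
`z₁ ^ r * v_k ^ q` at `(n, k)`, where `n = q (d - 1) + r`, `0 ≤ r < d - 1`. For `0 < d` all positions
have `k < d`, so the last branch does not occur. -/
def dirBasis (P : MvPolynomial (Fin 2) ℂ) {d : ℕ} (lam : Fin d → ℂ) (j : ℕ) : CoordRing P :=
  if (gridIndex d j).1 < d - 1 then monBasis P d j
  else if h : (gridIndex d j).2 < d then
    z₁ P ^ ((gridIndex d j).1 % (d - 1)) *
      dirPoly P lam ⟨(gridIndex d j).2, h⟩ ^ ((gridIndex d j).1 / (d - 1))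
  else 0

/-- The class `Z(k)` of all `z₂ ^ k * z₁ ^ n + lot_S`, where `lot_S` is any linear combination of the
elements of `S` that precede `z₂ ^ k * z₁ ^ n` in the grevlex order. -/
def zClass (P : MvPolynomial (Fin 2) ℂ) (d k : ℕ) : Set (CoordRing P) :=
  {p | ∃ n j : ℕ, gridIndex d j = (n + k, k) ∧
    ∃ r ∈ Submodule.span ℂ (monBasis P d '' {i | i < j}), p = z₂ P ^ k * z₁ P ^ n + r}

/-! Transfinite diameter with respect to a sequence `B` (indexed from `0`). -/

/-- `V_n(K, B)`: the supremum of `|det [b_i(ζ_j)]|` over `n`-tuples of points of `K`. -/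
def vdmSup (K : Set (curve P)) (B : ℕ → CoordRing P) (n : ℕ) : ℝ :=
  sSup {x | ∃ ζ : Fin n → curve P, (∀ j, ζ j ∈ K) ∧
    x = ‖(Matrix.of fun i j : Fin n => evalAt (ζ j) (B i)).det‖}

/-- `m_n`: the number of elements of `B` of degree at most `n`. -/
def countDeg (B : ℕ → CoordRing P) (n : ℕ) : ℕ := Set.ncard {j | deg (B j) ≤ n}

/-- `l_n`: the sum of the degrees of the first `m_n` elements of `B`. -/
def sumDeg (B : ℕ → CoordRing P) (n : ℕ) : ℕ := ∑ j ∈ Finset.range (countDeg B n), deg (B j)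

/-- The transfinite diameter `d_B(K) = limsup (V_{m_n}) ^ (1 / l_n)`. -/
def transDiam (K : Set (curve P)) (B : ℕ → CoordRing P) : ℝ :=
  limsup (fun n => vdmSup K B (countDeg B n) ^ (1 / (sumDeg B n : ℝ))) atTop

end AlgCurve

end

/-! The degree filtration of ℂ[A] has a simple associated graded object. A polynomial of degree at
most `n` is sent to the values of its degree-`n` component at the `d` points at infinity `(1, lam
k)`. Since the top form of `P` is a nonzero multiple of `∏ (z₂ - lam k * z₁)`, this vector in ℂ^d
depends only on the class in ℂ[A] (`HasLead.unique`), and it vanishes exactly when the class has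
degree below `n` (`HasLead.isLot`). Multiplication becomes coordinatewise: `z₁` goes to `1`, `z₂` to
`lam`, and `v_k` to the idempotent `e_k`. All the classes in the theorem are thus described by
leading vectors.

Let `τ_n(i)` be the least sup norm over elements of degree `n` with leading vector `e_i`. As `e_i`
is idempotent, products stay in these classes, so `τ` is submultiplicative and Fekete's lemma gives
`τ_n(i)^(1/n) → T i`. This limit is `T(K, lam_i)`.

An element monic at `z₁^(n-k) * z₂^k` (indices from `0`) has as leading vector the values at the
`lam i` of a monic polynomial `g` of degree `k`. Lower bound: by Lagrange interpolation `g` cannot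
be small at all of `lam 0, …, lam k`, and multiplying by `v_i` isolates the coordinate `i`, so the
extremal norm dominates a constant times `τ_{n+d-1}(i)` for some `i ≤ k`. Upper bound: choosing `g`
with zeros `lam 0, …, lam (k-1)` leaves only the coordinates `i ≥ k`, so the norm is at most a
constant times some `τ_n(i)` with `i ≥ k`. With `T` decreasing, both bounds give `T k`. For the
directional basis the leading vector is `e_k` plus a combination of earlier `e_i`, and the same
argument gives `T k` without using the order.

For the transfinite diameters, with `t_j` the extremal norm of the elements monic at position `j`,
expansion of determinants gives `t_j V_j ≤ V_{j+1} ≤ (j+1) t_j V_j`. Hence `V` is `∏ t_j` up to a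
factor that disappears in the root, and a weighted Cesàro mean of logarithms gives `(∏ T k)^(1/d)`
for either basis (`tendsto_root_of_grid`). -/

noncomputable section

namespace AlgCurve

/-! ### Homogeneous components through the substitution `(X, yX)`. -/

section

/-- The substitution `p ↦ p (X, y X)`, a polynomial in `X` over `ℂ[y]`. Its coefficient of `X ^ n` is
the dehomogenized component of degree `n`. -/
def blowup : MvPolynomial (Fin 2) ℂ →ₐ[ℂ] Polynomial (Polynomial ℂ) :=
  MvPolynomial.aeval ![Polynomial.X, Polynomial.C Polynomial.X * Polynomial.X]

lemma blowup_monomial (s : Fin 2 →₀ ℕ) (a : ℂ) :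
    blowup (MvPolynomial.monomial s a) =
      Polynomial.monomial (s 0 + s 1) (Polynomial.monomial (s 1) a) := by
  rw [blowup, MvPolynomial.aeval_monomial, Finsupp.prod_fintype _ _ (by simp), Fin.prod_univ_two]
  simp only [Matrix.cons_val_zero, Matrix.cons_val_one, ← Polynomial.C_mul_X_pow_eq_monomial,
    mul_pow, pow_add, Polynomial.C_mul, Polynomial.C_pow]
  rw [IsScalarTower.algebraMap_apply ℂ (Polynomial ℂ) (Polynomial (Polynomial ℂ))]
  simp only [Polynomial.algebraMap_eq]
  ring

lemma coeff_coeff_blowup (p : MvPolynomial (Fin 2) ℂ) (s : Fin 2 →₀ ℕ) :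
    ((blowup p).coeff (s 0 + s 1)).coeff (s 1) = p.coeff s := by
  induction p using MvPolynomial.induction_on' with
  | monomial u a =>
    rw [blowup_monomial, Polynomial.coeff_monomial, MvPolynomial.coeff_monomial]
    by_cases h : u = s
    · subst h; simp
    · rw [if_neg h]
      by_cases h0 : u 0 + u 1 = s 0 + s 1
      · rw [if_pos h0, Polynomial.coeff_monomial, if_neg]
        intro h1
        apply h
        ext i
        fin_cases i
        · simp; omega
        · simpa using h1
      · simp [h0]
  | add p q hp hq => simp [hp, hq]

lemma natDegree_coeff_blowup_le (p : MvPolynomial (Fin 2) ℂ) (n : ℕ) :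
    ((blowup p).coeff n).natDegree ≤ n := by
  induction p using MvPolynomial.induction_on' with
  | monomial u a =>
    rw [blowup_monomial, Polynomial.coeff_monomial]
    split_ifs with h
    · exact (Polynomial.natDegree_monomial_le _).trans (by omega)
    · simp
  | add p q hp hq =>
    rw [map_add, Polynomial.coeff_add]
    exact Polynomial.natDegree_add_le_of_degree_le hp hq

lemma natDegree_blowup_le_iff (p : MvPolynomial (Fin 2) ℂ) (n : ℕ) :
    (blowup p).natDegree ≤ n ↔ p.totalDegree ≤ n := by
  rw [Polynomial.natDegree_le_iff_coeff_eq_zero, MvPolynomial.totalDegree, Finset.sup_le_iff]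
  constructor
  · intro h s hs
    by_contra hlt
    rw [Finsupp.sum_fintype _ _ (by simp), Fin.sum_univ_two, not_le] at hlt
    rw [MvPolynomial.mem_support_iff, ← coeff_coeff_blowup, h _ hlt] at hs
    simp at hs
  · intro h m hm
    ext b
    rw [Polynomial.coeff_zero]
    rcases le_or_gt b m with hb | hb
    · by_contra hne
      let s : Fin 2 →₀ ℕ := Finsupp.equivFunOnFinite.symm ![m - b, b]
      have h0 : s 0 = m - b := rfl
      have h1 : s 1 = b := rfl
      have key := coeff_coeff_blowup p s
      rw [h0, h1, Nat.sub_add_cancel hb] at key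
      have := h s (by rw [MvPolynomial.mem_support_iff, ← key]; exact hne)
      rw [Finsupp.sum_fintype _ _ (by simp), Fin.sum_univ_two, h0, h1] at this
      omega
    · exact Polynomial.coeff_eq_zero_of_natDegree_lt
        ((natDegree_coeff_blowup_le p m).trans_lt hb)

lemma natDegree_blowup (p : MvPolynomial (Fin 2) ℂ) :
    (blowup p).natDegree = p.totalDegree :=
  le_antisymm ((natDegree_blowup_le_iff _ _).2 le_rfl) ((natDegree_blowup_le_iff _ _).1 le_rfl)

lemma blowup_injective : Function.Injective blowup := by
  intro p q h
  ext s
  rw [← coeff_coeff_blowup, h, coeff_coeff_blowup]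

/-- The homogenization of degree `n` of a polynomial in one variable. -/
def homogenize (n : ℕ) (g : Polynomial ℂ) : MvPolynomial (Fin 2) ℂ :=
  ∑ b ∈ Finset.range (n + 1),
    MvPolynomial.C (g.coeff b) * (MvPolynomial.X 0 ^ (n - b) * MvPolynomial.X 1 ^ b)

lemma blowup_homogenize {n : ℕ} {g : Polynomial ℂ} (hg : g.natDegree ≤ n) :
    blowup (homogenize n g) = Polynomial.monomial n g := by
  conv_rhs => rw [g.as_sum_range' (n + 1) (by omega)]
  rw [homogenize, map_sum, map_sum]
  refine Finset.sum_congr rfl fun b hb => ?_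
  have hb' : b ≤ n := by simpa [Nat.lt_succ_iff] using hb
  simp only [map_mul, map_pow, blowup, MvPolynomial.aeval_X, MvPolynomial.aeval_C,
    Matrix.cons_val_zero, Matrix.cons_val_one, ← Polynomial.C_mul_X_pow_eq_monomial]
  rw [IsScalarTower.algebraMap_apply ℂ (Polynomial ℂ) (Polynomial (Polynomial ℂ))]
  simp only [Polynomial.algebraMap_eq, mul_pow]
  have hX : (Polynomial.X : Polynomial (Polynomial ℂ)) ^ n = Polynomial.X ^ (n - b) * Polynomial.X ^ b := by
    rw [← pow_add, Nat.sub_add_cancel hb']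
  rw [hX]
  ring

lemma eval_blowup (p : MvPolynomial (Fin 2) ℂ) (x y : ℂ) :
    ((blowup p).map (Polynomial.evalRingHom y)).eval x = MvPolynomial.eval ![x, y * x] p := by
  induction p using MvPolynomial.induction_on with
  | C a => simp [blowup, IsScalarTower.algebraMap_apply ℂ (Polynomial ℂ) (Polynomial (Polynomial ℂ))]
  | add p q hp hq => simp [hp, hq]
  | mul_X p i hp =>
    rw [map_mul, Polynomial.map_mul, Polynomial.eval_mul, hp, map_mul]
    fin_cases i <;> simp [blowup]

/-- The top homogeneous part of `P`, of degree `d`, is a nonzero multiple of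
`∏ k, (z₂ - lam k * z₁)` with distinct `lam k`. -/
structure TopSplits (P : MvPolynomial (Fin 2) ℂ) {d : ℕ} (lam : Fin d → ℂ) : Prop where
  totalDegree_eq : P.totalDegree = d
  injective : Function.Injective lam
  two_le : 2 ≤ d
  exists_coeff : ∃ a : ℂ, a ≠ 0 ∧ (blowup P).coeff d =
    Polynomial.C a * ∏ k, (Polynomial.X - Polynomial.C (lam k))

/-! ### Slopes of asymptotes are the zeros of the top form. -/

/-- Points of the curve at bounded distance from the line go to infinity with ratio `z₂ / z₁`
tending to `lam`. Dividing `P = 0` by `z₁ ^ deg P` and passing to the limit leaves only the top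
component. -/
lemma IsLinearAsymptote.eval_coeff_eq_zero {P : MvPolynomial (Fin 2) ℂ} {lam c : ℂ}
    (h : IsLinearAsymptote (curve P) lam c) :
    ((blowup P).coeff P.totalDegree).eval lam = 0 := by
  obtain ⟨R, hR⟩ := h 1 one_pos
  obtain ⟨N, hN⟩ := exists_nat_gt (max R 1)
  -- Distance less than `1` is enough here. The sample points are `t = N + i` with `N > max R 1`, so
  -- that `‖w 0‖ ≥ i`.
  have hR' : ∀ i : ℕ, ∃ w ∈ curve P, ‖w - ![((N + i : ℕ) : ℂ), lam * ((N + i : ℕ) : ℂ) + c]‖ < 1 := by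
    intro i
    obtain ⟨w, hw, -, hlt⟩ := hR ((N + i : ℕ) : ℂ) (by
      rw [Complex.norm_natCast]
      push_cast
      have := le_max_left R 1
      have : (0 : ℝ) ≤ i := by positivity
      linarith)
    exact ⟨w, hw, hlt⟩
  choose w hw hlt using hR'
  have h0 : ∀ i, ‖w i 0 - ((N + i : ℕ) : ℂ)‖ < 1 := fun i => by
    simpa using (norm_le_pi_norm _ 0).trans_lt (hlt i)
  have h1 : ∀ i, ‖w i 1 - (lam * ((N + i : ℕ) : ℂ) + c)‖ < 1 := fun i => by
    simpa using (norm_le_pi_norm _ 1).trans_lt (hlt i)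
  have hinf : Tendsto (fun i => ‖w i 0‖) atTop atTop := by
    refine tendsto_atTop_mono (f := fun i : ℕ => (i : ℝ)) (fun i => ?_) tendsto_natCast_atTop_atTop
    have h2 := norm_sub_norm_le ((N + i : ℕ) : ℂ) (w i 0)
    rw [norm_sub_rev, Complex.norm_natCast] at h2
    have h3 := h0 i
    have h4 := le_max_right R 1
    push_cast at h2 h3
    linarith
  have hne : ∀ᶠ i in atTop, w i 0 ≠ 0 := by
    filter_upwards [hinf.eventually_gt_atTop 0] with i hi
    exact norm_pos_iff.1 hi
  have hinv : Tendsto (fun i => (w i 0)⁻¹) atTop (𝓝 0) :=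
    tendsto_inv₀_cobounded.comp (tendsto_norm_atTop_iff_cobounded.1 hinf)
  have hratio : Tendsto (fun i => w i 1 / w i 0) atTop (𝓝 lam) := by
    have hdiff : Tendsto (fun i => (w i 1 - lam * w i 0) * (w i 0)⁻¹) atTop (𝓝 0) := by
      refine squeeze_zero_norm (a := fun i => (1 + ‖lam‖ * 1 + ‖c‖) * ‖(w i 0)⁻¹‖) (fun i => ?_)
        (by simpa using hinv.norm.const_mul (1 + ‖lam‖ * 1 + ‖c‖))
      rw [norm_mul]
      gcongr
      calc ‖w i 1 - lam * w i 0‖ = ‖(w i 1 - (lam * ((N + i : ℕ) : ℂ) + c)) -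
            lam * (w i 0 - ((N + i : ℕ) : ℂ)) + c‖ := by ring_nf
        _ ≤ ‖w i 1 - (lam * ((N + i : ℕ) : ℂ) + c)‖ +
            ‖lam * (w i 0 - ((N + i : ℕ) : ℂ))‖ + ‖c‖ :=
          (norm_add_le _ _).trans (by gcongr; exact norm_sub_le _ _)
        _ ≤ _ := by
          rw [norm_mul]
          gcongr
          · exact (h1 i).le
          · exact (h0 i).le
    refine (by simpa using hdiff.add_const lam : Tendsto _ atTop (𝓝 lam)).congr' ?_
    filter_upwards [hne] with i hi
    field_simp
    ring
  have hlim : Tendsto (fun i => ∑ m ∈ Finset.range (P.totalDegree + 1),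
      ((blowup P).coeff m).eval (w i 1 / w i 0) * (w i 0)⁻¹ ^ (P.totalDegree - m)) atTop
      (𝓝 (∑ m ∈ Finset.range (P.totalDegree + 1),
        ((blowup P).coeff m).eval lam * 0 ^ (P.totalDegree - m))) :=
    tendsto_finsetSum _ fun m _ =>
      (((Polynomial.continuous _).tendsto _).comp hratio).mul (hinv.pow _)
  have hlhs : ∀ᶠ i in atTop, ∑ m ∈ Finset.range (P.totalDegree + 1),
      ((blowup P).coeff m).eval (w i 1 / w i 0) * (w i 0)⁻¹ ^ (P.totalDegree - m) = 0 := by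
    filter_upwards [hne] with i hi
    have hz : ![w i 0, w i 1 / w i 0 * w i 0] = w i := by
      ext k
      fin_cases k <;> simp [hi]
    have hP : MvPolynomial.eval (w i) P = 0 := hw i
    rw [← hz, ← eval_blowup, Polynomial.eval_eq_sum_range' (n := P.totalDegree + 1)
      (by rw [← natDegree_blowup]; exact Nat.lt_succ_of_le Polynomial.natDegree_map_le)] at hP
    rw [← mul_right_inj' (pow_ne_zero P.totalDegree hi), mul_zero, ← hP, Finset.mul_sum]
    refine Finset.sum_congr rfl fun m hm => ?_
    have hm' : m ≤ P.totalDegree := by simpa [Nat.lt_succ_iff] using hm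
    rw [Polynomial.coeff_map, Polynomial.coe_evalRingHom]
    conv_lhs => rw [← Nat.sub_add_cancel hm', pow_add, Nat.sub_add_cancel hm', inv_pow]
    field_simp
  have := tendsto_nhds_unique (hlim.congr' hlhs) tendsto_const_nhds
  rw [Finset.sum_range_succ, Finset.sum_eq_zero, zero_add, Nat.sub_self, pow_zero, mul_one] at this
  · exact this
  · intro m hm
    rw [zero_pow (by have := Finset.mem_range.1 hm; omega), mul_zero]

/-- The top component is nonzero of degree at most `d` in `y` and has the `d` distinct roots `lam
k`, so it is a constant times their product. -/
lemma topSplits_of_asymptotes {P : MvPolynomial (Fin 2) ℂ} {d : ℕ} (hd : 2 ≤ d)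
    (hdeg : P.totalDegree = d) {lam c : Fin d → ℂ} (hinj : Function.Injective lam)
    (h : ∀ k, IsLinearAsymptote (curve P) (lam k) (c k)) : TopSplits P lam := by
  refine ⟨hdeg, hinj, hd, ((blowup P).coeff d).coeff d, ?_⟩
  have hdvd : (∏ k, (Polynomial.X - Polynomial.C (lam k))) ∣ (blowup P).coeff d := by
    refine Finset.prod_dvd_of_coprime ?_ fun k _ => ?_
    · intro i _ j _ hij
      exact Polynomial.isCoprime_X_sub_C_of_isUnit_sub
        (sub_ne_zero.2 (hinj.ne hij)).isUnit
    · rw [Polynomial.dvd_iff_isRoot, Polynomial.IsRoot, ← (h k).eval_coeff_eq_zero, hdeg]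
  have hmon : (∏ k, (Polynomial.X - Polynomial.C (lam k))).Monic :=
    Polynomial.monic_prod_X_sub_C _ _
  have hnd : (∏ k, (Polynomial.X - Polynomial.C (lam k))).natDegree = d := by
    simp
  have hne : (blowup P).coeff d ≠ 0 := by
    intro h0
    have : (blowup P).natDegree = d := by rw [natDegree_blowup, hdeg]
    rw [← this, Polynomial.coeff_natDegree, Polynomial.leadingCoeff_eq_zero] at h0
    rw [h0] at this
    simp at this
    omega
  obtain ⟨q, hq⟩ := hdvd
  have hq0 : q ≠ 0 := by rintro rfl; simp at hq; exact hne hq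
  have hqd : q.natDegree = 0 := by
    have := natDegree_coeff_blowup_le P d
    rw [hq, hmon.natDegree_mul' hq0, hnd] at this
    omega
  obtain ⟨b, rfl⟩ := Polynomial.natDegree_eq_zero.1 hqd
  have hb : ((blowup P).coeff d).coeff d = b := by
    rw [hq, mul_comm, Polynomial.coeff_C_mul]
    have := hmon.coeff_natDegree
    rw [hnd] at this
    rw [this, mul_one]
  rw [hb]
  refine ⟨by rintro rfl; simp at hq0, by rw [hq, mul_comm]⟩

end

/-! ### Leading vectors at the points at infinity. -/

section

variable {P : MvPolynomial (Fin 2) ℂ} {d : ℕ} {lam : Fin d → ℂ}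

/-- `f` has a representative of degree at most `n` whose component of degree `n` takes the value
`v k` at `(1, lam k)`, for each `k`. -/
def HasLead (lam : Fin d → ℂ) (f : CoordRing P) (n : ℕ) (v : Fin d → ℂ) : Prop :=
  ∃ p : MvPolynomial (Fin 2) ℂ, toRing P p = f ∧ p.totalDegree ≤ n ∧
    ∀ k, ((blowup p).coeff n).eval (lam k) = v k

lemma single_one_pow (i : Fin d) {q : ℕ} (hq : q ≠ 0) :
    (Pi.single i 1 : Fin d → ℂ) ^ q = Pi.single i 1 := by
  ext j
  by_cases hj : j = i
  · simp [hj]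
  · simp [hj, hq]

lemma toRing_surjective : Function.Surjective (toRing P) := Ideal.Quotient.mk_surjective

lemma toRing_eq_zero_iff {p : MvPolynomial (Fin 2) ℂ} : toRing P p = 0 ↔ P ∣ p := by
  rw [toRing, Ideal.Quotient.eq_zero_iff_mem, Ideal.mem_span_singleton]

lemma smul_toRing (a : ℂ) (p : MvPolynomial (Fin 2) ℂ) : a • toRing P p = toRing P (a • p) := rfl

lemma deg_le {f : CoordRing P} {n : ℕ} (p : MvPolynomial (Fin 2) ℂ) (hp : toRing P p = f)
    (hn : p.totalDegree ≤ n) : deg f ≤ n :=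
  
  (Nat.sInf_le (s := {n | ∃ p : MvPolynomial (Fin 2) ℂ, toRing P p = f ∧ p.totalDegree = n})
    (m := p.totalDegree) ⟨p, hp, rfl⟩).trans hn

lemma exists_totalDegree_eq_deg (f : CoordRing P) :
    ∃ p : MvPolynomial (Fin 2) ℂ, toRing P p = f ∧ p.totalDegree = deg f := by
  obtain ⟨p, hp⟩ := toRing_surjective f
  exact Nat.sInf_mem (s := {n | ∃ p : MvPolynomial (Fin 2) ℂ, toRing P p = f ∧ p.totalDegree = n})
    ⟨_, p, hp, rfl⟩

namespace HasLead

lemma zero (n : ℕ) : HasLead lam (0 : CoordRing P) n 0 := ⟨0, by simp, by simp, by simp⟩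

lemma add {f g : CoordRing P} {n : ℕ} {v w : Fin d → ℂ} (hf : HasLead lam f n v)
    (hg : HasLead lam g n w) : HasLead lam (f + g) n (v + w) := by
  obtain ⟨p, rfl, hp, hv⟩ := hf
  obtain ⟨q, rfl, hq, hw⟩ := hg
  exact ⟨p + q, map_add _ _ _, (MvPolynomial.totalDegree_add _ _).trans (max_le hp hq),
    fun k => by simp [hv, hw]⟩

lemma smul {f : CoordRing P} {n : ℕ} {v : Fin d → ℂ} (a : ℂ) (hf : HasLead lam f n v) :
    HasLead lam (a • f) n (a • v) := by
  obtain ⟨p, rfl, hp, hv⟩ := hf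
  exact ⟨a • p, rfl, (MvPolynomial.totalDegree_smul_le _ _).trans hp, fun k => by simp [hv]⟩

lemma neg {f : CoordRing P} {n : ℕ} {v : Fin d → ℂ} (hf : HasLead lam f n v) :
    HasLead lam (-f) n (-v) := by
  simpa using hf.smul (-1)

lemma sub {f g : CoordRing P} {n : ℕ} {v w : Fin d → ℂ} (hf : HasLead lam f n v)
    (hg : HasLead lam g n w) : HasLead lam (f - g) n (v - w) := by
  rw [sub_eq_add_neg, sub_eq_add_neg]
  exact hf.add hg.neg

lemma sum {ι : Type*} (s : Finset ι) {f : ι → CoordRing P} {n : ℕ} {v : ι → Fin d → ℂ}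
    (h : ∀ i ∈ s, HasLead lam (f i) n (v i)) :
    HasLead lam (∑ i ∈ s, f i) n (∑ i ∈ s, v i) := by
  classical
  induction s using Finset.induction_on with
  | empty => simpa using zero n
  | insert a s ha ih =>
    rw [Finset.sum_insert ha, Finset.sum_insert ha]
    exact (h a (by simp)).add (ih fun i hi => h i (by simp [hi]))

lemma mul {f g : CoordRing P} {n m : ℕ} {v w : Fin d → ℂ} (hf : HasLead lam f n v)
    (hg : HasLead lam g m w) : HasLead lam (f * g) (n + m) (v * w) := by
  obtain ⟨p, rfl, hp, hv⟩ := hf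
  obtain ⟨q, rfl, hq, hw⟩ := hg
  refine ⟨p * q, map_mul _ _ _, (MvPolynomial.totalDegree_mul _ _).trans (by omega), fun k => ?_⟩
  rw [map_mul, Polynomial.coeff_mul_add_eq_of_natDegree_le ((natDegree_blowup_le_iff _ _).2 hp)
    ((natDegree_blowup_le_iff _ _).2 hq), Polynomial.eval_mul, hv, hw, Pi.mul_apply]

lemma one : HasLead lam (1 : CoordRing P) 0 1 := ⟨1, by simp, by simp, by simp⟩

lemma pow {f : CoordRing P} {n : ℕ} {v : Fin d → ℂ} (hf : HasLead lam f n v) (q : ℕ) :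
    HasLead lam (f ^ q) (q * n) (v ^ q) := by
  induction q with
  | zero => simpa using one
  | succ q ih => rw [pow_succ, pow_succ, Nat.succ_mul]; exact ih.mul hf

lemma zero_of_deg_lt {f : CoordRing P} {n : ℕ} (h : deg f < n) : HasLead lam f n 0 := by
  obtain ⟨p, hp, hd⟩ := exists_totalDegree_eq_deg f
  refine ⟨p, hp, by omega, fun k => ?_⟩
  rw [Polynomial.coeff_eq_zero_of_natDegree_lt (by rw [natDegree_blowup]; omega)]
  simp

lemma zero_of_isLot {f : CoordRing P} {n : ℕ} (h : IsLot f n) : HasLead lam f n 0 := by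
  rcases h with rfl | h
  · exact zero n
  · exact zero_of_deg_lt h

lemma deg_le {f : CoordRing P} {n : ℕ} {v : Fin d → ℂ} (hf : HasLead lam f n v) : deg f ≤ n := by
  obtain ⟨p, hp, hn, -⟩ := hf
  exact AlgCurve.deg_le p hp hn

lemma exists_of_deg_le {f : CoordRing P} {n : ℕ} (h : deg f ≤ n) : ∃ v, HasLead lam f n v := by
  obtain ⟨p, hp, hd⟩ := exists_totalDegree_eq_deg f
  exact ⟨_, p, hp, by omega, fun k => rfl⟩

lemma z₁ : HasLead lam (z₁ P) 1 1 :=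
  ⟨MvPolynomial.X 0, rfl, by simp, fun k => by simp [blowup]⟩

lemma z₂ : HasLead lam (z₂ P) 1 lam :=
  ⟨MvPolynomial.X 1, rfl, by simp, fun k => by simp [blowup]⟩

lemma monomial {n k : ℕ} (hk : k ≤ n) :
    HasLead lam (AlgCurve.z₁ P ^ (n - k) * AlgCurve.z₂ P ^ k) n (lam ^ k) := by
  have := (z₁ (P := P) (lam := lam).pow (n - k)).mul ((z₂ (P := P) (lam := lam)).pow k)
  rwa [one_pow, one_mul, mul_one, mul_one, Nat.sub_add_cancel hk] at this

/-- On the line `z₁ = 1` the polynomial `v_k` is the Lagrange basis polynomial of the nodes `lam j`,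
so its leading vector is the idempotent `e_k`. -/
lemma dirPoly (hinj : Function.Injective lam) (k : Fin d) :
    HasLead lam (dirPoly P lam k) (d - 1) (Pi.single k 1) := by
  have key : ∀ s : Finset (Fin d), HasLead lam (toRing P (∏ j ∈ s,
      MvPolynomial.C (lam k - lam j)⁻¹ *
      (MvPolynomial.X 1 - MvPolynomial.C (lam j) * MvPolynomial.X 0))) s.card
      (fun i => ∏ j ∈ s, (lam k - lam j)⁻¹ * (lam i - lam j)) := by
    intro s
    induction s using Finset.induction_on with
    | empty => rw [Finset.prod_empty, map_one]; exact one
    | insert a s ha ih =>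
      simp only [Finset.prod_insert ha, Finset.card_insert_of_notMem ha]
      rw [add_comm, map_mul]
      refine HasLead.mul ?_ ih
      have := ((z₂ (P := P) (lam := lam)).sub ((z₁ (P := P) (lam := lam)).smul (lam a))).smul
        (lam k - lam a)⁻¹
      convert this using 1
      · rw [AlgCurve.z₁, AlgCurve.z₂, smul_toRing, ← map_sub, smul_toRing, MvPolynomial.smul_eq_C_mul,
          MvPolynomial.smul_eq_C_mul]
      · ext i; simp
  have := key (Finset.univ.erase k)
  rw [Finset.card_erase_of_mem (Finset.mem_univ _), Finset.card_univ, Fintype.card_fin] at this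
  suffices h : (Pi.single k 1 : Fin d → ℂ) = fun i =>
      ∏ j ∈ Finset.univ.erase k, (lam k - lam j)⁻¹ * (lam i - lam j) by
    rw [h]; exact this
  ext i
  by_cases hi : i = k
  · subst hi
    rw [Pi.single_eq_same, Finset.prod_eq_one]
    intro j hj
    exact inv_mul_cancel₀ (sub_ne_zero.2 (hinj.ne (Finset.ne_of_mem_erase hj).symm))
  · rw [Pi.single_eq_of_ne hi, Finset.prod_eq_zero (Finset.mem_erase.2 ⟨hi, Finset.mem_univ _⟩)]
    simp

/-- Two representatives differ by a multiple `P * q`. Its leading component is the top form of `P`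
times a component of `q`, and the top form vanishes at every `(1, lam k)`. -/
lemma unique (hP : TopSplits P lam) {f : CoordRing P} {n : ℕ} {v w : Fin d → ℂ}
    (hv : HasLead lam f n v) (hw : HasLead lam f n w) : v = w := by
  suffices h : ∀ v, HasLead lam (0 : CoordRing P) n v → v = 0 from
    sub_eq_zero.1 (h _ (by simpa using hv.sub hw))
  rintro v ⟨p, hp, hn, hv⟩
  obtain ⟨a, -, ha⟩ := hP.exists_coeff
  obtain ⟨q, rfl⟩ := toRing_eq_zero_iff.1 hp
  ext k
  rw [← hv k, Pi.zero_apply]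
  by_cases hq : q = 0
  · simp [hq]
  have hP0 : P ≠ 0 := by
    rintro rfl
    have := hP.totalDegree_eq
    have := hP.two_le
    simp at *
    omega
  have hdeg := MvPolynomial.totalDegree_mul_of_isDomain hP0 hq
  rw [hP.totalDegree_eq] at hdeg
  obtain ⟨m, rfl⟩ : ∃ m, n = d + m := ⟨n - d, by omega⟩
  rw [map_mul, Polynomial.coeff_mul_add_eq_of_natDegree_le
    ((natDegree_blowup_le_iff _ _).2 hP.totalDegree_eq.le)
    ((natDegree_blowup_le_iff _ _).2 (by omega)), Polynomial.eval_mul, ha, Polynomial.eval_mul,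
    Polynomial.eval_prod, Finset.prod_eq_zero (Finset.mem_univ k) (by simp)]
  simp

lemma deg_eq (hP : TopSplits P lam) {f : CoordRing P} {n : ℕ} {v : Fin d → ℂ}
    (hf : HasLead lam f n v) (hv : v ≠ 0) : deg f = n := by
  refine le_antisymm hf.deg_le (not_lt.1 fun h => hv ?_)
  exact hf.unique hP (zero_of_deg_lt h)

/-- A leading component vanishing at all `(1, lam k)` is divisible by the top form of `P`.
Subtracting the homogenized quotient times `P` removes that component without changing the class. -/
lemma isLot (hP : TopSplits P lam) {f : CoordRing P} {n : ℕ} (hf : HasLead lam f n 0) :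
    IsLot f n := by
  obtain ⟨p, rfl, hn, hv⟩ := hf
  obtain ⟨a, ha0, ha⟩ := hP.exists_coeff
  have hdvd : (∏ k, (Polynomial.X - Polynomial.C (lam k))) ∣ (blowup p).coeff n := by
    refine Finset.prod_dvd_of_coprime ?_ fun k _ => ?_
    · intro i _ j _ hij
      exact Polynomial.isCoprime_X_sub_C_of_isUnit_sub
        (sub_ne_zero.2 (hP.injective.ne hij)).isUnit
    · rw [Polynomial.dvd_iff_isRoot, Polynomial.IsRoot]; exact hv k
  obtain ⟨q, hq⟩ := hdvd
  have hmon : (∏ k, (Polynomial.X - Polynomial.C (lam k))).Monic :=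
    Polynomial.monic_prod_X_sub_C _ _
  have hnd : (∏ k, (Polynomial.X - Polynomial.C (lam k))).natDegree = d := by simp
  suffices h : ∃ p' : MvPolynomial (Fin 2) ℂ, toRing P p' = toRing P p ∧ p'.totalDegree ≤ n ∧
      (blowup p').coeff n = 0 by
    obtain ⟨p', hp', hd', h0⟩ := h
    rw [← hp']
    by_cases hlt : p'.totalDegree < n
    · exact Or.inr (lt_of_le_of_lt (AlgCurve.deg_le p' rfl le_rfl) hlt)
    · left
      have heq : p'.totalDegree = n := by omega
      rw [← heq, ← natDegree_blowup, Polynomial.coeff_natDegree,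
        Polynomial.leadingCoeff_eq_zero] at h0
      rw [blowup_injective (h0.trans (map_zero _).symm), map_zero]
  by_cases hq0 : q = 0
  · exact ⟨p, rfl, hn, by rw [hq, hq0, mul_zero]⟩
  have hle := natDegree_coeff_blowup_le p n
  rw [hq, hmon.natDegree_mul' hq0, hnd] at hle
  obtain ⟨m, rfl⟩ : ∃ m, n = d + m := ⟨n - d, by omega⟩
  have hqa : (Polynomial.C a⁻¹ * q).natDegree ≤ m :=
    (Polynomial.natDegree_C_mul_le _ _).trans (by omega)
  have hb := blowup_homogenize hqa
  refine ⟨p - homogenize m (Polynomial.C a⁻¹ * q) * P, ?_, ?_, ?_⟩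
  · rw [map_sub, map_mul, (toRing_eq_zero_iff (p := P)).2 dvd_rfl, mul_zero, sub_zero]
  · rw [sub_eq_add_neg]
    refine (MvPolynomial.totalDegree_add _ _).trans (max_le hn ?_)
    rw [MvPolynomial.totalDegree_neg]
    refine (MvPolynomial.totalDegree_mul _ _).trans ?_
    have : (homogenize m (Polynomial.C a⁻¹ * q)).totalDegree ≤ m := by
      rw [← natDegree_blowup, hb]
      exact Polynomial.natDegree_monomial_le _
    rw [hP.totalDegree_eq]
    omega
  · rw [map_sub, map_mul, hb, Polynomial.coeff_sub, Polynomial.coeff_monomial_mul, hq, ha]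
    have : Polynomial.C a⁻¹ * Polynomial.C a = (1 : Polynomial ℂ) := by
      rw [← Polynomial.C_mul, inv_mul_cancel₀ ha0, Polynomial.C_1]
    linear_combination (-q * ∏ k, (Polynomial.X - Polynomial.C (lam k))) * this

/-- The leading values of an element are the values of a polynomial in one variable. -/
lemma exists_polynomial {f : CoordRing P} {n : ℕ} {v : Fin d → ℂ} (hf : HasLead lam f n v) :
    ∃ g : Polynomial ℂ, g.degree < (min (n + 1) d : ℕ) ∧ ∀ i, g.eval (lam i) = v i := by
  obtain ⟨p, -, -, hv⟩ := hf
  have hmon : (∏ k, (Polynomial.X - Polynomial.C (lam k))).Monic :=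
    Polynomial.monic_prod_X_sub_C _ _
  have hnd : (∏ k, (Polynomial.X - Polynomial.C (lam k))).natDegree = d := by simp
  -- Reduction modulo the nodal polynomial keeps the values at the nodes. It brings the degree below
  -- `d` and does not raise it above the original bound `n`.
  refine ⟨(blowup p).coeff n %ₘ ∏ k, (Polynomial.X - Polynomial.C (lam k)), ?_, fun i => ?_⟩
  · suffices h : ∀ m : ℕ, m = n + 1 ∨ m = d → ((blowup p).coeff n %ₘ
        ∏ k, (Polynomial.X - Polynomial.C (lam k))).degree < (m : WithBot ℕ) by
      rcases min_choice (n + 1) d with h' | h' <;> rw [h'] <;> exact h _ (by simp)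
    rintro m (rfl | rfl)
    · refine (Polynomial.degree_modByMonic_le_left).trans_lt ?_
      refine Polynomial.degree_le_natDegree.trans_lt ?_
      exact_mod_cast Nat.lt_succ_of_le (natDegree_coeff_blowup_le p n)
    · have := Polynomial.degree_modByMonic_lt ((blowup p).coeff n) hmon
      rwa [Polynomial.degree_eq_natDegree hmon.ne_zero, hnd] at this
  · rw [← hv i]
    conv_rhs => rw [← Polynomial.modByMonic_add_div ((blowup p).coeff n)
      (∏ k, (Polynomial.X - Polynomial.C (lam k)))]
    have h0 : ∏ k, (Polynomial.X - Polynomial.C (lam k)).eval (lam i) = 0 :=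
      Finset.prod_eq_zero (Finset.mem_univ i) (by simp)
    rw [Polynomial.eval_add, Polynomial.eval_mul, Polynomial.eval_prod, h0, zero_mul, add_zero]

end HasLead

/-! The enumeration `gridIndex`. -/

/-- The position of `(n, 0)` in the listing of pairs. -/
def gridStart (d n : ℕ) : ℕ := ∑ s ∈ Finset.range n, min (s + 1) d

lemma gridStart_succ (d n : ℕ) : gridStart d (n + 1) = gridStart d n + min (n + 1) d :=
  Finset.sum_range_succ _ _

lemma gridStart_mono (d : ℕ) : Monotone (gridStart d) :=
  monotone_nat_of_le_succ fun n => by rw [gridStart_succ]; omega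

lemma gridIndex_succ (d j : ℕ) : gridIndex d (j + 1) = nextIndex d (gridIndex d j) := by
  rw [gridIndex, Function.iterate_succ_apply', gridIndex]

lemma gridIndex_spec (hd : 0 < d) (j : ℕ) :
    (gridIndex d j).2 < min ((gridIndex d j).1 + 1) d ∧
      j = gridStart d (gridIndex d j).1 + (gridIndex d j).2 := by
  induction j with
  | zero => simp [gridIndex, gridStart, hd]
  | succ j ih =>
    obtain ⟨h1, h2⟩ := ih
    rw [gridIndex_succ, nextIndex]
    split_ifs with h
    · exact ⟨h, by simp only; omega⟩
    · refine ⟨by simp [hd], ?_⟩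
      simp only [gridStart_succ]
      omega

lemma gridIndex_gridStart_add {n k : ℕ} (hk : k < min (n + 1) d) :
    gridIndex d (gridStart d n + k) = (n, k) := by
  have hd : 0 < d := by omega
  obtain ⟨h1, h2⟩ := gridIndex_spec hd (gridStart d n + k)
  generalize gridIndex d (gridStart d n + k) = x at h1 h2
  obtain ⟨n', k'⟩ := x
  simp only at h1 h2
  rcases lt_trichotomy n n' with h | rfl | h
  · have := gridStart_mono d (Nat.succ_le_of_lt h)
    rw [Nat.succ_eq_add_one, gridStart_succ] at this
    omega
  · simp; omega
  · have := gridStart_mono d (Nat.succ_le_of_lt h)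
    rw [Nat.succ_eq_add_one, gridStart_succ] at this
    omega

lemma exists_eq_gridStart_add (hd : 0 < d) (j : ℕ) :
    ∃ n k, k < min (n + 1) d ∧ j = gridStart d n + k :=
  ⟨_, _, gridIndex_spec hd j⟩

lemma gridIndex_fst_le_iff (hd : 0 < d) (j n : ℕ) :
    (gridIndex d j).1 ≤ n ↔ j < gridStart d (n + 1) := by
  obtain ⟨m, k, hk, rfl⟩ := exists_eq_gridStart_add hd j
  rw [gridIndex_gridStart_add hk]
  simp only
  constructor
  · intro h
    have h' := gridStart_mono d (Nat.succ_le_succ h)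
    simp only [Nat.succ_eq_add_one] at h'
    rw [gridStart_succ d m] at h'
    omega
  · intro h
    by_contra hlt
    have := gridStart_mono d (Nat.succ_le_of_lt (not_le.1 hlt))
    simp only [Nat.succ_eq_add_one] at this
    omega

/-! Sequences adapted to the degree filtration. -/

/-- `B` lists, degree by degree, elements of leading values `u n k`, which span all leading values in
degree `n`. -/
structure LeadSystem (lam : Fin d → ℂ) (B : ℕ → CoordRing P) (u : ℕ → ℕ → Fin d → ℂ) : Prop where
  hasLead : ∀ n k, k < min (n + 1) d → HasLead lam (B (gridStart d n + k)) n (u n k)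
  ne_zero : ∀ n k, k < min (n + 1) d → u n k ≠ 0
  mem_span : ∀ n v, (∃ f : CoordRing P, HasLead lam f n v) →
    v ∈ Submodule.span ℂ (u n '' {i | i < min (n + 1) d})

namespace LeadSystem

variable {B : ℕ → CoordRing P} {u : ℕ → ℕ → Fin d → ℂ}

lemma deg_eq (hB : LeadSystem lam B u) (hP : TopSplits P lam) (j : ℕ) :
    deg (B j) = (gridIndex d j).1 := by
  obtain ⟨n, k, hk, rfl⟩ := exists_eq_gridStart_add (by have := hP.two_le; omega : 0 < d) j
  rw [gridIndex_gridStart_add hk]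
  exact (hB.hasLead n k hk).deg_eq hP (hB.ne_zero n k hk)

lemma exists_lead_of_mem_span (hB : LeadSystem lam B u) (hP : TopSplits P lam) {n k : ℕ}
    (hk : k ≤ min (n + 1) d) {r : CoordRing P}
    (hr : r ∈ Submodule.span ℂ (B '' {i | i < gridStart d n + k})) :
    ∃ w ∈ Submodule.span ℂ (u n '' {i | i < k}), HasLead lam r n w := by
  induction hr using Submodule.span_induction with
  | zero => exact ⟨0, zero_mem _, .zero n⟩
  | add x y _ _ hx hy =>
    obtain ⟨v, hv, hv'⟩ := hx
    obtain ⟨w, hw, hw'⟩ := hy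
    exact ⟨v + w, add_mem hv hw, hv'.add hw'⟩
  | smul a x _ hx =>
    obtain ⟨v, hv, hv'⟩ := hx
    exact ⟨a • v, Submodule.smul_mem _ _ hv, hv'.smul a⟩
  | mem x hx =>
    obtain ⟨i, hi, rfl⟩ := hx
    rw [Set.mem_ofPred_eq] at hi
    have hd0 : 0 < d := by have := hP.two_le; omega
    obtain ⟨n', k', hk', rfl⟩ := exists_eq_gridStart_add hd0 i
    rcases lt_trichotomy n' n with h | rfl | h
    · exact ⟨0, zero_mem _, .zero_of_deg_lt ((hB.hasLead n' k' hk').deg_le.trans_lt h)⟩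
    · exact ⟨_, Submodule.subset_span ⟨k', by simpa using hi, rfl⟩, hB.hasLead n' k' hk'⟩
    · have := gridStart_mono d (Nat.succ_le_of_lt h)
      rw [Nat.succ_eq_add_one, gridStart_succ] at this
      omega

lemma exists_mem_span_of_lead (hB : LeadSystem lam B u) {n k : ℕ} (hk : k ≤ min (n + 1) d)
    {w : Fin d → ℂ} (hw : w ∈ Submodule.span ℂ (u n '' {i | i < k})) :
    ∃ r ∈ Submodule.span ℂ (B '' {i | i < gridStart d n + k}), HasLead lam r n w := by
  induction hw using Submodule.span_induction with
  | zero => exact ⟨0, zero_mem _, .zero n⟩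
  | add x y _ _ hx hy =>
    obtain ⟨v, hv, hv'⟩ := hx
    obtain ⟨w, hw, hw'⟩ := hy
    exact ⟨v + w, add_mem hv hw, hv'.add hw'⟩
  | smul a x _ hx =>
    obtain ⟨v, hv, hv'⟩ := hx
    exact ⟨a • v, Submodule.smul_mem _ _ hv, hv'.smul a⟩
  | mem x hx =>
    obtain ⟨i, hi, rfl⟩ := hx
    rw [Set.mem_ofPred_eq] at hi
    exact ⟨_, Submodule.subset_span ⟨_, by simpa using hi, rfl⟩, hB.hasLead n i (by omega)⟩

/-- Subtracting a combination with the same leading vector lowers the degree. The remainder lies in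
the span of all elements of smaller degree by induction, since the leading vectors span in each
degree. -/
lemma mem_span_of_lead (hB : LeadSystem lam B u) (hP : TopSplits P lam) {n k : ℕ}
    (hk : k ≤ min (n + 1) d) {f : CoordRing P} {w : Fin d → ℂ} (hf : HasLead lam f n w)
    (hw : w ∈ Submodule.span ℂ (u n '' {i | i < k})) :
    f ∈ Submodule.span ℂ (B '' {i | i < gridStart d n + k}) := by
  induction n generalizing f k w with
  | zero =>
    obtain ⟨r, hr, hr'⟩ := hB.exists_mem_span_of_lead hk hw
    have h0 := hf.sub hr'
    rw [sub_self] at h0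
    rcases h0.isLot hP with h | h
    · rwa [sub_eq_zero.1 h]
    · omega
  | succ n ih =>
    obtain ⟨r, hr, hr'⟩ := hB.exists_mem_span_of_lead hk hw
    have h0 := hf.sub hr'
    rw [sub_self] at h0
    rcases h0.isLot hP with h | h
    · rwa [sub_eq_zero.1 h]
    · obtain ⟨v, hv⟩ := HasLead.exists_of_deg_le (lam := lam) (Nat.le_of_lt_succ h)
      have := ih le_rfl hv (hB.mem_span n v ⟨_, hv⟩)
      rw [← gridStart_succ] at this
      rw [← sub_add_cancel f r]
      refine add_mem (Submodule.span_mono (Set.image_mono fun i hi => ?_) this) hr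
      exact lt_of_lt_of_le hi (Nat.le_add_right _ _)

end LeadSystem

/-! ### Leading vectors of the two bases. -/

/-- Spanning is interpolation: every leading vector of degree `n` consists of the values of a
polynomial of degree less than `min (n + 1) d`. Nonvanishing of the slopes makes the vectors `lam ^
k` nonzero. -/
lemma leadSystem_monBasis (hP : TopSplits P lam) (hne : ∀ k, lam k ≠ 0) :
    LeadSystem lam (monBasis P d) (fun _ k => lam ^ k) where
  hasLead n k hk := by
    rw [monBasis, gridIndex_gridStart_add hk]
    exact .monomial (by omega)
  ne_zero n k hk h := pow_ne_zero k (hne ⟨0, by omega⟩) (congrFun h _)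
  mem_span n v hv := by
    obtain ⟨f, hf⟩ := hv
    obtain ⟨g, hg, hv⟩ := hf.exists_polynomial
    have : v = ∑ i ∈ Finset.range (min (n + 1) d), g.coeff i • lam ^ i := by
      ext i
      rw [← hv i, Polynomial.eval_eq_sum_range' (n := min (n + 1) d)]
      swap
      · rcases eq_or_ne g 0 with rfl | hg0
        · have := hP.two_le
          simp
          omega
        · exact (Polynomial.natDegree_lt_iff_degree_lt hg0).2 hg
      simp
    rw [this]
    exact Submodule.sum_mem _ fun i hi => Submodule.smul_mem _ _
      (Submodule.subset_span ⟨i, Finset.mem_range.1 hi, rfl⟩)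

/-- The leading values of the directional basis. -/
def dirLead (lam : Fin d → ℂ) (n k : ℕ) : Fin d → ℂ :=
  if n < d - 1 then lam ^ k else if h : k < d then Pi.single ⟨k, h⟩ 1 else 0

lemma leadSystem_dirBasis (hP : TopSplits P lam) (hne : ∀ k, lam k ≠ 0) :
    LeadSystem lam (dirBasis P lam) (dirLead lam) where
  hasLead n k hk := by
    rw [dirBasis, gridIndex_gridStart_add hk, dirLead]
    simp only
    split_ifs with h1 h2
    · exact (leadSystem_monBasis hP hne).hasLead n k hk
    · have := ((HasLead.z₁ (P := P) (lam := lam)).pow (n % (d - 1))).mul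
        ((HasLead.dirPoly hP.injective ⟨k, h2⟩).pow (n / (d - 1)))
      -- The exponent of `v_k` must be positive: `e_k ^ 0` is the all-ones vector, not `e_k`.
      have hq : n / (d - 1) ≠ 0 :=
        (Nat.div_pos (not_lt.1 h1) (by have := hP.two_le; omega)).ne'
      rwa [one_pow, one_mul, mul_one, Nat.mod_add_div', single_one_pow _ hq] at this
    · omega
  ne_zero n k hk := by
    rw [dirLead]
    split_ifs with h1 h2
    · exact (leadSystem_monBasis hP hne).ne_zero n k hk
    · intro h
      simpa using congrFun h ⟨k, h2⟩
    · omega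
  mem_span n v hv := by
    by_cases h1 : n < d - 1
    · have := (leadSystem_monBasis hP hne).mem_span n v hv
      have h2 : dirLead lam n = fun k => lam ^ k := by ext k; simp [dirLead, h1]
      rwa [h2]
    · have : v = ∑ i, v i • Pi.single i 1 := by
        ext j
        simp [Finset.sum_apply, Pi.single_apply]
      rw [this]
      refine Submodule.sum_mem _ fun i _ => Submodule.smul_mem _ _ (Submodule.subset_span ⟨i, ?_, ?_⟩)
      · rw [Set.mem_ofPred_eq]; omega
      · simp [dirLead, h1]

end

section

/-! Asymptotics of `n`-th roots. -/

lemma rpow_one_div_nonneg {a : ℝ} (ha : 0 ≤ a) (n : ℕ) : 0 ≤ a ^ (1 / (n : ℝ)) :=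
  Real.rpow_nonneg ha _

/-- Fekete's lemma in multiplicative form. -/
lemma exists_tendsto_of_submultiplicative {a : ℕ → ℝ} (ha : ∀ n, 0 ≤ a n)
    (hmul : ∀ m n, a (m + n) ≤ a m * a n) :
    ∃ T, 0 ≤ T ∧ Tendsto (fun n => a n ^ (1 / (n : ℝ))) atTop (𝓝 T) := by
  -- The numbers `a n` may vanish, so logarithms are taken after truncation below by `δ ^ n`, which
  -- preserves submultiplicativity and bounds the averages from below.
  have key : ∀ δ : ℝ, 0 < δ → ∃ L, δ ≤ L ∧
      Tendsto (fun n => max (a n ^ (1 / (n : ℝ))) δ) atTop (𝓝 L) := by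
    intro δ hδ
    have hpos : ∀ n, 0 < max (a n) (δ ^ n) := fun n => lt_max_of_lt_right (by positivity)
    have hsub : Subadditive fun n => Real.log (max (a n) (δ ^ n)) := by
      intro m n
      rw [← Real.log_mul (hpos m).ne' (hpos n).ne']
      refine Real.log_le_log (hpos _) (max_le ?_ ?_)
      · exact (hmul m n).trans (mul_le_mul (le_max_left _ _) (le_max_left _ _) (ha n) (hpos m).le)
      · rw [pow_add]
        exact mul_le_mul (le_max_right _ _) (le_max_right _ _) (by positivity) (hpos m).le
    have hlow : ∀ n : ℕ, n ≠ 0 → Real.log δ ≤ Real.log (max (a n) (δ ^ n)) / n := by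
      intro n hn
      rw [le_div_iff₀ (by positivity), mul_comm, ← Real.log_pow]
      exact Real.log_le_log (by positivity) (le_max_right _ _)
    have hbdd : BddBelow (Set.range fun n : ℕ => Real.log (max (a n) (δ ^ n)) / n) := by
      refine ⟨min (Real.log δ) 0, ?_⟩
      rintro _ ⟨n, rfl⟩
      rcases eq_or_ne n 0 with rfl | hn
      · simp
      · exact (min_le_left _ _).trans (hlow n hn)
    have hlim : Tendsto (fun n => max (a n ^ (1 / (n : ℝ))) δ) atTop (𝓝 (Real.exp hsub.lim)) := by
      refine (Real.continuous_exp.tendsto _ |>.comp (hsub.tendsto_lim hbdd)).congr' ?_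
      filter_upwards [eventually_ne_atTop 0] with n hn
      have hn' : (0 : ℝ) < n := by positivity
      have h1 : (δ ^ n) ^ (1 / (n : ℝ)) = δ := by
        rw [one_div, Real.pow_rpow_inv_natCast hδ.le hn]
      conv_rhs => rw [← h1]
      rw [← (Real.monotoneOn_rpow_Ici_of_exponent_nonneg (r := 1 / (n : ℝ)) (by positivity)).map_max
        (ha n) (by simp; positivity), Real.rpow_def_of_pos (hpos n)]
      simp [div_eq_mul_inv]
    exact ⟨_, ge_of_tendsto' hlim fun n => le_max_right _ _, hlim⟩
  -- If some truncated limit exceeds its `δ`, the truncation is eventually inactive and the limit is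
  -- genuine. Otherwise every truncated limit equals its `δ`, which forces the limit `0`.
  by_cases h : ∃ δ : ℝ, 0 < δ ∧ ∃ L, δ < L ∧
      Tendsto (fun n => max (a n ^ (1 / (n : ℝ))) δ) atTop (𝓝 L)
  · obtain ⟨δ, hδ, L, hL, hlim⟩ := h
    refine ⟨L, by linarith, hlim.congr' ?_⟩
    filter_upwards [hlim.eventually (lt_mem_nhds hL)] with n hn
    rcases lt_max_iff.1 hn with h | h
    · exact max_eq_left h.le
    · exact absurd h (lt_irrefl _)
  · refine ⟨0, le_rfl, Metric.tendsto_atTop'.2 fun ε hε => ?_⟩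
    push Not at h
    obtain ⟨L, hL, hlim⟩ := key (ε / 2) (by positivity)
    have hL' : L = ε / 2 := by
      by_contra hne
      exact h (ε / 2) (by positivity) L (lt_of_le_of_ne hL (Ne.symm hne)) hlim
    obtain ⟨N, hN⟩ := (hlim.eventually (gt_mem_nhds (show L < ε by linarith))).exists_forall_of_atTop
    refine ⟨N, fun n hn => ?_⟩
    rw [Real.dist_eq, sub_zero, abs_of_nonneg (rpow_one_div_nonneg (ha n) n)]
    exact (le_max_left _ _).trans_lt (hN n hn.le)

lemma tendsto_const_rpow_one_div {C : ℝ} (hC : 0 < C) :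
    Tendsto (fun n : ℕ => C ^ (1 / (n : ℝ))) atTop (𝓝 1) := by
  have := tendsto_one_div_atTop_nhds_zero_nat (𝕜 := ℝ)
  simpa [Function.comp_def] using (Real.continuousAt_const_rpow hC.ne').tendsto.comp this

lemma tendsto_shift_root {x : ℕ → ℝ} {T C : ℝ} (hx : ∀ n, 0 ≤ x n) (hC : 0 < C)
    (h : Tendsto (fun n => x n ^ (1 / (n : ℝ))) atTop (𝓝 T)) (s : ℕ) :
    Tendsto (fun n => (C * x (n + s)) ^ (1 / (n : ℝ))) atTop (𝓝 T) := by
  have hT : 0 ≤ T := ge_of_tendsto' h fun n => rpow_one_div_nonneg (hx n) n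
  have h1 := (tendsto_add_atTop_iff_nat s).2 h
  have h2 : Tendsto (fun n : ℕ => ((n + s : ℕ) : ℝ) / n) atTop (𝓝 1) := by
    have : Tendsto (fun n : ℕ => 1 + (s : ℝ) / n) atTop (𝓝 (1 + 0)) :=
      tendsto_const_nhds.add (tendsto_const_div_atTop_nhds_zero_nat _)
    rw [add_zero] at this
    refine this.congr' ?_
    filter_upwards [eventually_ne_atTop 0] with n hn
    push_cast
    field_simp
  have h3 := (tendsto_const_rpow_one_div hC).mul (h1.rpow h2 (Or.inr one_pos))
  rw [one_mul, Real.rpow_one] at h3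
  refine h3.congr' ?_
  filter_upwards [eventually_ne_atTop 0] with n hn
  rw [Real.mul_rpow hC.le (hx _), ← Real.rpow_mul (hx _)]
  congr 2
  have : ((n + s : ℕ) : ℝ) ≠ 0 := by positivity
  field_simp

/-- The index that gives the bound may change with `n`. As there are finitely many indices, the root
estimates hold for all of them simultaneously from some `n` on. -/
lemma eventually_lt_root_of_exists_le {ι : Type*} [Finite ι] {x : ι → ℕ → ℝ} {t : ℕ → ℝ}
    {T : ι → ℝ} {p : ι → Prop} {a : ℝ} (hx : ∀ i n, 0 ≤ x i n)
    (hlim : ∀ i, Tendsto (fun n => x i n ^ (1 / (n : ℝ))) atTop (𝓝 (T i)))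
    (hp : ∀ i, p i → a < T i) (h : ∀ᶠ n in atTop, ∃ i, p i ∧ x i n ≤ t n) :
    ∀ᶠ n : ℕ in atTop, a < t n ^ (1 / (n : ℝ)) := by
  have h1 : ∀ᶠ n : ℕ in atTop, ∀ i, p i → a < x i n ^ (1 / (n : ℝ)) := by
    rw [eventually_all]
    intro i
    by_cases hi : p i
    · filter_upwards [(hlim i).eventually (lt_mem_nhds (hp i hi))] with n hn _ using hn
    · simp [hi]
  filter_upwards [h, h1] with n ⟨i, hi, hle⟩ hn
  exact (hn i hi).trans_le (Real.rpow_le_rpow (hx i n) hle (by positivity))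

lemma eventually_root_lt_of_exists_le {ι : Type*} [Finite ι] {y : ι → ℕ → ℝ} {t : ℕ → ℝ}
    {T : ι → ℝ} {p : ι → Prop} {a : ℝ} (ht : ∀ n, 0 ≤ t n)
    (hlim : ∀ i, Tendsto (fun n => y i n ^ (1 / (n : ℝ))) atTop (𝓝 (T i)))
    (hp : ∀ i, p i → T i < a) (h : ∀ᶠ n in atTop, ∃ i, p i ∧ t n ≤ y i n) :
    ∀ᶠ n : ℕ in atTop, t n ^ (1 / (n : ℝ)) < a := by
  have h1 : ∀ᶠ n : ℕ in atTop, ∀ i, p i → y i n ^ (1 / (n : ℝ)) < a := by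
    rw [eventually_all]
    intro i
    by_cases hi : p i
    · filter_upwards [(hlim i).eventually (gt_mem_nhds (hp i hi))] with n hn _ using hn
    · simp [hi]
  filter_upwards [h, h1] with n ⟨i, hi, hle⟩ hn
  exact (Real.rpow_le_rpow (ht n) hle (by positivity)).trans_lt (hn i hi)

/-- Comparison of `n`-th roots with finitely many sequences of known root asymptotics. -/
lemma tendsto_root_of_exists_le {ι : Type*} [Finite ι] {x y : ι → ℕ → ℝ} {t : ℕ → ℝ}
    {T : ι → ℝ} {T₀ : ℝ} {p q : ι → Prop} (ht : ∀ n, 0 ≤ t n) (hx : ∀ i n, 0 ≤ x i n)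
    (hlimx : ∀ i, Tendsto (fun n => x i n ^ (1 / (n : ℝ))) atTop (𝓝 (T i)))
    (hlimy : ∀ i, Tendsto (fun n => y i n ^ (1 / (n : ℝ))) atTop (𝓝 (T i)))
    (hp : ∀ i, p i → T₀ ≤ T i) (hq : ∀ i, q i → T i ≤ T₀)
    (hlow : ∀ᶠ n in atTop, ∃ i, p i ∧ x i n ≤ t n)
    (hup : ∀ᶠ n in atTop, ∃ i, q i ∧ t n ≤ y i n) :
    Tendsto (fun n => t n ^ (1 / (n : ℝ))) atTop (𝓝 T₀) :=
  tendsto_order.2 ⟨fun _ ha => eventually_lt_root_of_exists_le hx hlimx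
      (fun i hi => ha.trans_le (hp i hi)) hlow,
    fun _ ha => eventually_root_lt_of_exists_le ht hlimy
      (fun i hi => (hq i hi).trans_lt ha) hup⟩

lemma le_sInf_mul {S : Set ℝ} (hS : S.Nonempty) {b c : ℝ} (hb : 0 ≤ b)
    (h : ∀ x ∈ S, c ≤ x * b) : c ≤ sInf S * b := by
  rcases hb.eq_or_lt with rfl | hb
  · obtain ⟨x, hx⟩ := hS
    simpa using h x hx
  · rw [← div_le_iff₀ hb]
    exact le_csInf hS fun x hx => (div_le_iff₀ hb).2 (h x hx)

/-! The transfinite diameter: weighted means of logarithms. -/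

/-- The sum of the first components of the pairs at positions before `(N, 0)`. -/
def gridWeight (d N : ℕ) : ℕ := ∑ n ∈ Finset.range N, n * min (n + 1) d

/-- The geometric means of numbers at the grid positions, for positive root limits. -/
lemma tendsto_prod_root {d : ℕ} (hd : 0 < d) {a : ℕ → ℕ → ℝ} {T : Fin d → ℝ}
    (hT : ∀ k, 0 < T k) (ha : ∀ n k, k < min (n + 1) d → 0 < a n k)
    (hlim : ∀ k : Fin d, Tendsto (fun n => a n k ^ (1 / (n : ℝ))) atTop (𝓝 (T k))) :
    Tendsto (fun N => (∏ n ∈ Finset.range (N + 1), ∏ k ∈ Finset.range (min (n + 1) d), a n k) ^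
      (1 / (gridWeight d (N + 1) : ℝ))) atTop (𝓝 ((∏ k, T k) ^ (1 / (d : ℝ)))) := by
  have hprod : ∀ n, 0 < ∏ k ∈ Finset.range (min (n + 1) d), a n k := fun n =>
    Finset.prod_pos fun k hk => ha n k (Finset.mem_range.1 hk)
  set b : ℕ → ℝ := fun n => ∑ k ∈ Finset.range (min (n + 1) d), Real.log (a n k) with hb
  set L : ℝ := 1 / d * ∑ k, Real.log (T k) with hL
  have hd' : (0 : ℝ) < d := by exact_mod_cast hd
  have hblim : Tendsto (fun n : ℕ => b n / (n * d : ℝ)) atTop (𝓝 L) := by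
    have h1 : Tendsto (fun n : ℕ => 1 / (d : ℝ) * ∑ k : Fin d, Real.log (a n k ^ (1 / (n : ℝ))))
        atTop (𝓝 L) :=
      (tendsto_finsetSum _ fun k _ => (hlim k).log (hT k).ne').const_mul _
    refine h1.congr' ?_
    filter_upwards [eventually_ge_atTop d] with n hn
    have hmin : min (n + 1) d = d := by omega
    rw [hb]
    simp only [hmin]
    rw [Finset.sum_range, Finset.mul_sum, Finset.sum_div]
    refine Finset.sum_congr rfl fun k _ => ?_
    rw [Real.log_rpow (ha n k (by omega))]
    have : (n : ℝ) ≠ 0 := by norm_cast; omega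
    field_simp
  have hlittle : (fun n => b n - L * ((n * min (n + 1) d : ℕ) : ℝ)) =o[atTop]
      (fun n => ((n * min (n + 1) d : ℕ) : ℝ)) := by
    -- The block of degree `n` has weight `n * min (n + 1) d`, which is `n * d` eventually. Little-o
    -- estimates pass to partial sums because the total weight diverges, and this yields the
    -- weighted Cesàro mean.
    rw [Asymptotics.isLittleO_iff_tendsto']
    · have h2 := hblim.sub_const L
      rw [sub_self] at h2
      refine h2.congr' ?_
      filter_upwards [eventually_ge_atTop d] with n hn
      have hmin : min (n + 1) d = d := by omega
      have : (n : ℝ) ≠ 0 := by norm_cast; omega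
      rw [hmin]
      push_cast
      field_simp
    · filter_upwards [eventually_ge_atTop d] with n hn h0
      exfalso
      norm_cast at h0
      rw [Nat.mul_eq_zero] at h0
      omega
  have hwinf : Tendsto (fun N => ∑ n ∈ Finset.range N, ((n * min (n + 1) d : ℕ) : ℝ)) atTop atTop := by
    rw [← tendsto_add_atTop_iff_nat 1]
    refine tendsto_atTop_mono (fun N => ?_) tendsto_natCast_atTop_atTop
    rw [Finset.sum_range_succ]
    have h3 : (0 : ℝ) ≤ ∑ n ∈ Finset.range N, ((n * min (n + 1) d : ℕ) : ℝ) := by positivity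
    have h4 : (N : ℝ) ≤ ((N * min (N + 1) d : ℕ) : ℝ) := by
      exact_mod_cast Nat.le_mul_of_pos_right N (by omega)
    linarith
  have hsum := hlittle.sum_range (fun n => Nat.cast_nonneg _) hwinf
  have hmean : Tendsto (fun N => (∑ n ∈ Finset.range N, b n) / (gridWeight d N : ℝ)) atTop (𝓝 L) := by
    have h5 := hsum.tendsto_div_nhds_zero.add_const L
    rw [zero_add] at h5
    refine h5.congr' ?_
    filter_upwards [hwinf.eventually_gt_atTop 0] with N hN
    rw [gridWeight, Nat.cast_sum, Finset.sum_sub_distrib, ← Finset.mul_sum]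
    field_simp
    ring
  have hexp := (Real.continuous_exp.tendsto _).comp ((tendsto_add_atTop_iff_nat 1).2 hmean)
  have hLexp : Real.exp L = (∏ k, T k) ^ (1 / (d : ℝ)) := by
    rw [Real.rpow_def_of_pos (Finset.prod_pos fun k _ => hT k),
      Real.log_prod fun k _ => (hT k).ne', hL, mul_comm]
  rw [hLexp] at hexp
  refine hexp.congr fun N => ?_
  rw [Real.rpow_def_of_pos (Finset.prod_pos fun n _ => hprod n),
    Real.log_prod fun n _ => (hprod n).ne', Function.comp_apply, div_eq_mul_one_div]
  congr 2
  refine Finset.sum_congr rfl fun n _ => ?_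
  rw [Real.log_prod fun k hk => (ha n k (Finset.mem_range.1 hk)).ne']

lemma gridStart_le (d n : ℕ) : gridStart d n ≤ n * d := by
  calc gridStart d n ≤ ∑ s ∈ Finset.range n, d := Finset.sum_le_sum fun s _ => min_le_right _ _
    _ = n * d := by simp

/-- The position of `(n, k)` grows at most linearly in `n`, so the Laplace factor `j + 1` has `n`-th
root tending to `1`. -/
lemma tendsto_grid_factor_root {d : ℕ} {a : ℕ → ℕ → ℝ} {T : Fin d → ℝ}
    (ha : ∀ n k, 0 ≤ a n k)
    (hlim : ∀ k : Fin d, Tendsto (fun n => a n k ^ (1 / (n : ℝ))) atTop (𝓝 (T k))) (k : Fin d) :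
    Tendsto (fun n => (((gridStart d n + k : ℕ) + 1 : ℝ) * a n k) ^ (1 / (n : ℝ)))
      atTop (𝓝 (T k)) := by
  have hd : 0 < d := k.pos
  have h1 : Tendsto (fun n : ℕ => ((gridStart d n + k : ℕ) + 1 : ℝ) ^ (1 / (n : ℝ))) atTop (𝓝 1) := by
    have h2 : Tendsto (fun n : ℕ => (2 * d : ℝ) ^ (1 / (n : ℝ)) * (n : ℝ) ^ (1 / (n : ℝ)))
        atTop (𝓝 (1 * 1)) :=
      (tendsto_const_rpow_one_div (by positivity)).mul
        (tendsto_rpow_div.comp tendsto_natCast_atTop_atTop)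
    rw [mul_one] at h2
    refine tendsto_of_tendsto_of_tendsto_of_le_of_le' tendsto_const_nhds h2 ?_ ?_
    · exact .of_forall fun n => Real.one_le_rpow (by simp; positivity) (by positivity)
    · filter_upwards [eventually_ge_atTop 1] with n hn
      rw [← Real.mul_rpow (by positivity) (by positivity)]
      refine Real.rpow_le_rpow (by positivity) ?_ (by positivity)
      have h3 := gridStart_le d n
      have h4 := k.2
      have h5 : d ≤ n * d := Nat.le_mul_of_pos_left d hn
      have h6 : gridStart d n + k + 1 ≤ 2 * d * n := by nlinarith
      exact_mod_cast h6
  have := h1.mul (hlim k)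
  rw [one_mul] at this
  refine this.congr fun n => ?_
  rw [Real.mul_rpow (by positivity) (ha n k)]

/-- Root asymptotics of a sequence that is multiplicatively controlled along the grid. -/
lemma tendsto_root_of_grid {d : ℕ} (hd : 0 < d) {V t : ℕ → ℝ} {T : Fin d → ℝ}
    (hV0 : V 0 = 1) (hV : ∀ j, 0 ≤ V j) (ht : ∀ j, 0 ≤ t j) (hT : ∀ k, 0 ≤ T k)
    (hlow : ∀ j, t j * V j ≤ V (j + 1)) (hup : ∀ j, V (j + 1) ≤ (j + 1) * t j * V j)
    (hlim : ∀ k : Fin d, Tendsto (fun n => t (gridStart d n + k) ^ (1 / (n : ℝ))) atTop (𝓝 (T k)))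
    (hpos : (∀ k, 0 < T k) → ∀ j, 0 < t j) :
    Tendsto (fun N => V (gridStart d (N + 1)) ^ (1 / (gridWeight d (N + 1) : ℝ))) atTop
      (𝓝 ((∏ k, T k) ^ (1 / (d : ℝ)))) := by
  have hregroup : ∀ (f : ℕ → ℝ) (N : ℕ), ∏ j ∈ Finset.range (gridStart d N), f j =
      ∏ n ∈ Finset.range N, ∏ k ∈ Finset.range (min (n + 1) d), f (gridStart d n + k) := by
    intro f N
    induction N with
    | zero => simp [gridStart]
    | succ N ih => rw [gridStart_succ, Finset.prod_range_add, ih, Finset.prod_range_succ]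
  have hlow' : ∀ m, ∏ j ∈ Finset.range m, t j ≤ V m := by
    intro m
    induction m with
    | zero => simp [hV0]
    | succ m ih =>
      rw [Finset.prod_range_succ, mul_comm]
      exact (mul_le_mul_of_nonneg_left ih (ht m)).trans (hlow m)
  have hup' : ∀ (s : ℕ → ℝ), (∀ j : ℕ, ((j : ℝ) + 1) * t j ≤ s j) →
      ∀ m, V m ≤ ∏ j ∈ Finset.range m, s j := by
    intro s hs m
    have hs0 : ∀ j, 0 ≤ s j := fun j => (mul_nonneg (by positivity) (ht j)).trans (hs j)
    induction m with
    | zero => simp [hV0]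
    | succ m ih =>
      rw [Finset.prod_range_succ, mul_comm]
      exact (hup m).trans (mul_le_mul (hs m) ih (hV m) (hs0 m))
  have hfac := tendsto_grid_factor_root (fun n k => ht (gridStart d n + k)) hlim
  -- The mean theorem needs positive limits, so the upper product is truncated below by `δ ^ n` in
  -- degree `n`. Letting `δ → 0` afterwards gives the upper bound, even when some `T k` is zero.
  have hnear : ∀ δ : ℝ, 0 < δ → Tendsto (fun N => (∏ j ∈ Finset.range (gridStart d (N + 1)),
      max (((j : ℝ) + 1) * t j) (δ ^ (gridIndex d j).1)) ^ (1 / (gridWeight d (N + 1) : ℝ))) atTop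
      (𝓝 ((∏ k, max (T k) δ) ^ (1 / (d : ℝ)))) := by
    intro δ hδ
    simp only [hregroup]
    refine tendsto_prod_root hd
      (a := fun n k => max (((gridStart d n + k : ℕ) + 1 : ℝ) * t (gridStart d n + k))
        (δ ^ (gridIndex d (gridStart d n + k)).1)) (fun k => lt_max_of_lt_right hδ)
      (fun n k _ => lt_max_of_lt_right (by positivity)) fun k => ?_
    refine ((hfac k).max tendsto_const_nhds).congr' ?_
    filter_upwards [eventually_ge_atTop d] with n hn
    rw [gridIndex_gridStart_add (by omega)]
    have hn0 : n ≠ 0 := by omega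
    have h1 : (δ ^ n) ^ (1 / (n : ℝ)) = δ := by
      rw [one_div, Real.pow_rpow_inv_natCast hδ.le hn0]
    conv_lhs => rw [← h1]
    rw [← (Real.monotoneOn_rpow_Ici_of_exponent_nonneg (r := 1 / (n : ℝ)) (by positivity)).map_max
        (Set.mem_Ici.2 (mul_nonneg (by positivity) (ht _))) (Set.mem_Ici.2 (by positivity))]
  have hlt : ∀ b, (∏ k, T k) ^ (1 / (d : ℝ)) < b → ∀ᶠ N in atTop,
      V (gridStart d (N + 1)) ^ (1 / (gridWeight d (N + 1) : ℝ)) < b := by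
    intro b hb
    have hcont : Tendsto (fun δ : ℝ => (∏ k, max (T k) δ) ^ (1 / (d : ℝ))) (𝓝[>] 0)
        (𝓝 ((∏ k, T k) ^ (1 / (d : ℝ)))) := by
      have h2 : Continuous fun δ : ℝ => (∏ k, max (T k) δ) ^ (1 / (d : ℝ)) :=
        (continuous_finsetProd _ fun k _ => continuous_const.max continuous_id).rpow_const
          fun _ => Or.inr (by positivity)
      have h3 := h2.tendsto 0
      simp only [max_eq_left (hT _)] at h3
      exact h3.mono_left nhdsWithin_le_nhds
    obtain ⟨δ, hδb, hδ⟩ := ((hcont.eventually (gt_mem_nhds hb)).and self_mem_nhdsWithin).exists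
    filter_upwards [(hnear δ hδ).eventually (gt_mem_nhds hδb)] with N hN
    refine lt_of_le_of_lt (Real.rpow_le_rpow (hV _) ?_ (by positivity)) hN
    exact hup' _ (fun j => le_max_left _ _) _
  refine tendsto_order.2 ⟨fun b hb => ?_, hlt⟩
  -- A single zero `t j` would kill the lower product, so positivity of every term is needed here.
  -- If some `T k` is zero, the claimed limit is zero and the lower bound is trivial.
  by_cases hall : ∀ k, 0 < T k
  · have h4 := tendsto_prod_root hd (a := fun n k => t (gridStart d n + k)) hall
      (fun n k _ => hpos hall _) hlim
    filter_upwards [h4.eventually (lt_mem_nhds hb)] with N hN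
    refine hN.trans_le (Real.rpow_le_rpow ?_ ?_ (by positivity))
    · exact Finset.prod_nonneg fun n _ => Finset.prod_nonneg fun k _ => ht _
    · rw [← hregroup]
      exact hlow' _
  · push Not at hall
    obtain ⟨k, hk⟩ := hall
    rw [Finset.prod_eq_zero (Finset.mem_univ k) (le_antisymm hk (hT k)),
      Real.zero_rpow (by positivity)] at hb
    exact .of_forall fun N => hb.trans_le (Real.rpow_nonneg (hV _) _)

end

/-! ### Sup norms on `K` and extremal norms of classes. -/

section

variable {P : MvPolynomial (Fin 2) ℂ} {d : ℕ} {lam : Fin d → ℂ} {K : Set (curve P)}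

lemma evalAt_toRing (z : curve P) (p : MvPolynomial (Fin 2) ℂ) :
    evalAt z (toRing P p) = MvPolynomial.eval z.1 p := rfl

lemma evalAt_smul (z : curve P) (a : ℂ) (f : CoordRing P) : evalAt z (a • f) = a * evalAt z f := by
  obtain ⟨p, rfl⟩ := toRing_surjective f
  rw [smul_toRing, evalAt_toRing, evalAt_toRing, MvPolynomial.smul_eval]

lemma continuous_evalAt (f : CoordRing P) : Continuous fun z : curve P => evalAt z f := by
  obtain ⟨p, rfl⟩ := toRing_surjective f
  exact (MvPolynomial.continuous_eval p).comp continuous_subtype_val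

lemma normOn_nonneg (f : CoordRing P) : 0 ≤ normOn K f :=
  Real.sSup_nonneg (by rintro _ ⟨z, -, rfl⟩; exact norm_nonneg _)

lemma normOn_le {f : CoordRing P} {c : ℝ} (hc : 0 ≤ c) (h : ∀ z ∈ K, ‖evalAt z f‖ ≤ c) :
    normOn K f ≤ c :=
  Real.sSup_le (by rintro _ ⟨z, hz, rfl⟩; exact h z hz) hc

lemma norm_evalAt_le (hK : IsCompact K) (f : CoordRing P) {z : curve P} (hz : z ∈ K) :
    ‖evalAt z f‖ ≤ normOn K f :=
  le_csSup (hK.bddAbove_image (continuous_evalAt f).norm.continuousOn) ⟨z, hz, rfl⟩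

lemma normOn_mul_le (hK : IsCompact K) (f g : CoordRing P) :
    normOn K (f * g) ≤ normOn K f * normOn K g := by
  refine normOn_le (mul_nonneg (normOn_nonneg f) (normOn_nonneg g)) fun z hz => ?_
  rw [map_mul, norm_mul]
  exact mul_le_mul (norm_evalAt_le hK f hz) (norm_evalAt_le hK g hz) (norm_nonneg _)
    (normOn_nonneg f)

lemma normOn_smul_le (hK : IsCompact K) (a : ℂ) (f : CoordRing P) :
    normOn K (a • f) ≤ ‖a‖ * normOn K f := by
  refine normOn_le (mul_nonneg (norm_nonneg a) (normOn_nonneg f)) fun z hz => ?_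
  rw [evalAt_smul, norm_mul]
  exact mul_le_mul_of_nonneg_left (norm_evalAt_le hK f hz) (norm_nonneg a)

lemma normOn_sum_le (hK : IsCompact K) {ι : Type*} (s : Finset ι) (f : ι → CoordRing P) :
    normOn K (∑ i ∈ s, f i) ≤ ∑ i ∈ s, normOn K (f i) := by
  refine normOn_le (Finset.sum_nonneg fun i _ => normOn_nonneg _) fun z hz => ?_
  rw [map_sum]
  exact (norm_sum_le _ _).trans (Finset.sum_le_sum fun i _ => norm_evalAt_le hK _ hz)

lemma normOn_pow_le (hK : IsCompact K) (f : CoordRing P) (n : ℕ) :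
    normOn K (f ^ n) ≤ normOn K f ^ n := by
  refine normOn_le (pow_nonneg (normOn_nonneg f) n) fun z hz => ?_
  rw [map_pow, norm_pow]
  exact pow_le_pow_left₀ (norm_nonneg _) (norm_evalAt_le hK f hz) n

/-- The infimum of the sup norms of the elements of a class. -/
def infNorm (K : Set (curve P)) (N : Set (CoordRing P)) : ℝ := sInf (normOn K '' N)

lemma infNorm_nonneg (N : Set (CoordRing P)) : 0 ≤ infNorm K N :=
  Real.sInf_nonneg (by rintro _ ⟨f, -, rfl⟩; exact normOn_nonneg f)

lemma infNorm_le {N : Set (CoordRing P)} {f : CoordRing P} (hf : f ∈ N) :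
    infNorm K N ≤ normOn K f :=
  csInf_le ⟨0, by rintro _ ⟨f, -, rfl⟩; exact normOn_nonneg f⟩ ⟨f, hf, rfl⟩

lemma le_infNorm {N : Set (CoordRing P)} (hN : N.Nonempty) {c : ℝ}
    (h : ∀ f ∈ N, c ≤ normOn K f) : c ≤ infNorm K N :=
  le_csInf (hN.image _) (by rintro _ ⟨f, hf, rfl⟩; exact h f hf)

lemma exists_normOn_lt {N : Set (CoordRing P)} (hN : N.Nonempty) {c : ℝ} (h : infNorm K N < c) :
    ∃ f ∈ N, normOn K f < c := by
  obtain ⟨_, ⟨f, hf, rfl⟩, hlt⟩ := exists_lt_of_csInf_lt (hN.image (normOn K)) h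
  exact ⟨f, hf, hlt⟩

lemma le_infNorm_mul {N : Set (CoordRing P)} (hN : N.Nonempty) {b c : ℝ} (hb : 0 ≤ b)
    (h : ∀ f ∈ N, c ≤ normOn K f * b) : c ≤ infNorm K N * b :=
  le_sInf_mul (hN.image _) hb (by rintro _ ⟨f, hf, rfl⟩; exact h f hf)

/-! Directional Chebyshev constants. -/

/-- The elements of degree `n` with leading values those of a power of the directional
polynomial `v_i`. -/
def dirClass (P : MvPolynomial (Fin 2) ℂ) (lam : Fin d → ℂ) (n : ℕ) (i : Fin d) :
    Set (CoordRing P) :=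
  {f | HasLead lam f n (Pi.single i 1)}

lemma z₁_pow_mul_mem_dirClass {n : ℕ} {i : Fin d} {f : CoordRing P} (hf : f ∈ dirClass P lam n i)
    (m : ℕ) : z₁ P ^ m * f ∈ dirClass P lam (m + n) i := by
  have := (HasLead.z₁ (P := P) (lam := lam).pow m).mul hf
  rwa [one_pow, one_mul, mul_one] at this

lemma dirClass_nonempty (hinj : Function.Injective lam) {n : ℕ} (hn : d - 1 ≤ n) (i : Fin d) :
    (dirClass P lam n i).Nonempty := by
  have := z₁_pow_mul_mem_dirClass (HasLead.dirPoly (P := P) hinj i) (n - (d - 1))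
  rw [Nat.sub_add_cancel hn] at this
  exact ⟨_, this⟩

/-- The idempotent relation `e_i * e_i = e_i` keeps a product of two competitors in the class. -/
lemma infNorm_dirClass_mul_le (hK : IsCompact K) (hinj : Function.Injective lam) {m n : ℕ}
    (hm : d - 1 ≤ m) (hn : d - 1 ≤ n) (i : Fin d) :
    infNorm K (dirClass P lam (m + n) i) ≤
      infNorm K (dirClass P lam m i) * infNorm K (dirClass P lam n i) := by
  refine le_infNorm_mul (dirClass_nonempty hinj hm i) (infNorm_nonneg _) fun f hf => ?_
  rw [mul_comm]
  refine le_infNorm_mul (dirClass_nonempty hinj hn i) (normOn_nonneg _) fun g hg => ?_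
  rw [mul_comm]
  refine (infNorm_le ?_).trans (normOn_mul_le hK f g)
  have := HasLead.mul hf hg
  rwa [← Pi.single_mul, one_mul] at this

lemma infNorm_dirClass_add_le (hK : IsCompact K) (hinj : Function.Injective lam) (m : ℕ) {n : ℕ}
    (hn : d - 1 ≤ n) (i : Fin d) :
    infNorm K (dirClass P lam (m + n) i) ≤
      normOn K (z₁ P) ^ m * infNorm K (dirClass P lam n i) := by
  rw [mul_comm]
  refine le_infNorm_mul (dirClass_nonempty hinj hn i) (pow_nonneg (normOn_nonneg _) _) fun f hf => ?_
  rw [mul_comm]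
  refine (infNorm_le (z₁_pow_mul_mem_dirClass hf m)).trans ((normOn_mul_le hK _ _).trans ?_)
  exact mul_le_mul_of_nonneg_right (normOn_pow_le hK _ _) (normOn_nonneg _)

lemma exists_tendsto_infNorm_dirClass (hK : IsCompact K) (hinj : Function.Injective lam)
    (hd : 2 ≤ d) (i : Fin d) :
    ∃ T, 0 ≤ T ∧ Tendsto (fun n : ℕ => infNorm K (dirClass P lam n i) ^ (1 / (n : ℝ))) atTop
      (𝓝 T) := by
  set τ : ℕ → ℝ := fun n => infNorm K (dirClass P lam n i) with hτ
  set C : ℝ := max 1 (max (normOn K (z₁ P)) (normOn K (dirPoly P lam i))) with hC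
  have hC1 : 1 ≤ C := le_max_left _ _
  have hCz : normOn K (z₁ P) ≤ C := (le_max_left _ _).trans (le_max_right _ _)
  have hCv : normOn K (dirPoly P lam i) ≤ C := (le_max_right _ _).trans (le_max_right _ _)
  have hτ0 : ∀ n, 0 ≤ τ n := fun n => infNorm_nonneg _
  have hz : ∀ m n, d - 1 ≤ n → τ (m + n) ≤ C ^ m * τ n := fun m n hn =>
    (infNorm_dirClass_add_le hK hinj m hn i).trans
      (mul_le_mul_of_nonneg_right (pow_le_pow_left₀ (normOn_nonneg _) hCz m) (hτ0 n))
  have hbound : ∀ n, d - 1 ≤ n → τ n ≤ C ^ n := by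
    intro n hn
    have h1 := hz (n - (d - 1)) (d - 1) le_rfl
    rw [Nat.sub_add_cancel hn] at h1
    calc τ n ≤ C ^ (n - (d - 1)) * τ (d - 1) := h1
      _ ≤ C ^ (n - (d - 1)) * C :=
        mul_le_mul_of_nonneg_left ((infNorm_le (HasLead.dirPoly hinj i)).trans hCv) (by positivity)
      _ = C ^ (n - (d - 1) + 1) := (pow_succ _ _).symm
      _ ≤ C ^ n := pow_le_pow_right₀ hC1 (by omega)
  -- Below degree `d - 1` the class is empty and its infimum takes the default value `0`, which
  -- would break submultiplicativity. The powers `C ^ n` replace these values without affecting the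
  -- limit.
  obtain ⟨T, hT, hlim⟩ := exists_tendsto_of_submultiplicative
    (a := fun n => if n < d - 1 then C ^ n else τ n)
    (fun n => by split_ifs <;> [positivity; exact hτ0 n]) (fun m n => by
      by_cases hm : m < d - 1 <;> by_cases hn : n < d - 1 <;> simp only [hm, hn, if_true, if_false]
      · split_ifs with h
        · rw [pow_add]
        · rw [← pow_add]; exact hbound _ (not_lt.1 h)
      · rw [if_neg (by omega)]; exact hz m n (not_lt.1 hn)
      · rw [if_neg (by omega), add_comm, mul_comm]; exact hz n m (not_lt.1 hm)
      · rw [if_neg (by omega)]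
        exact infNorm_dirClass_mul_le hK hinj (not_lt.1 hm) (not_lt.1 hn) i)
  refine ⟨T, hT, hlim.congr' ?_⟩
  filter_upwards [eventually_ge_atTop (d - 1)] with n hn
  rw [if_neg (not_lt.2 hn)]

/-- Multiplication by powers of `z₁` preserves the leading vector, so a zero extremal norm in one
degree would propagate to all higher degrees and force the limit `0`. -/
lemma infNorm_dirClass_pos (hK : IsCompact K) (hinj : Function.Injective lam) {i : Fin d} {T : ℝ}
    (hT : 0 < T) (h : Tendsto (fun n : ℕ => infNorm K (dirClass P lam n i) ^ (1 / (n : ℝ))) atTop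
      (𝓝 T)) {n : ℕ} (hn : d - 1 ≤ n) : 0 < infNorm K (dirClass P lam n i) := by
  refine lt_of_le_of_ne (infNorm_nonneg _) fun h0 => ?_
  obtain ⟨m, hm, hmn⟩ := ((h.eventually (lt_mem_nhds hT)).and (eventually_gt_atTop n)).exists
  have h1 := infNorm_dirClass_add_le hK hinj (m - n) hn i
  rw [Nat.sub_add_cancel hmn.le, ← h0, mul_zero] at h1
  rw [le_antisymm h1 (infNorm_nonneg _), Real.zero_rpow (by
    have : (m : ℝ) ≠ 0 := by norm_cast; omega
    positivity)] at hm
  exact lt_irrefl _ hm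

lemma hasLead_of_mem_monicClass (hinj : Function.Injective lam) (hP : TopSplits P lam)
    {i : Fin d} {p : CoordRing P} (hp : p ∈ monicClass (dirPoly P lam i)) :
    p = 1 ∨ ∃ q, q ≠ 0 ∧ HasLead lam p (q * (d - 1)) (Pi.single i 1) := by
  obtain ⟨q, r, hr, rfl⟩ := hp
  rcases eq_or_ne q 0 with rfl | hq
  · left
    have h1 : deg (dirPoly P lam i ^ 0) = 0 := by
      have := (HasLead.one (P := P) (lam := lam)).deg_le
      rw [pow_zero]
      omega
    rcases hr with rfl | hr
    · simp
    · omega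
  · right
    have h1 := (HasLead.dirPoly (P := P) hinj i).pow q
    rw [single_one_pow i hq] at h1
    have h2 := h1.deg_eq hP (fun h => by simpa using congrFun h i)
    rw [h2] at hr
    have := h1.add (HasLead.zero_of_isLot hr)
    rw [add_zero] at this
    exact ⟨q, hq, this⟩

end

section

variable {P : MvPolynomial (Fin 2) ℂ} {d : ℕ} {lam : Fin d → ℂ} {K : Set (curve P)}
  {B : ℕ → CoordRing P}

/-! Chebyshev constants and Vandermonde determinants of a sequence. -/

/-- The elements `B j + (linear combination of the preceding elements)`. -/
def monicAt (B : ℕ → CoordRing P) (j : ℕ) : Set (CoordRing P) :=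
  {f | ∃ r ∈ Submodule.span ℂ (B '' {i | i < j}), f = B j + r}

lemma monicAt_nonempty (B : ℕ → CoordRing P) (j : ℕ) : (monicAt B j).Nonempty :=
  ⟨_, 0, zero_mem _, rfl⟩

/-- The generalized Vandermonde matrix `[B_i (ζ_j)]`. -/
def vdmMatrix (B : ℕ → CoordRing P) {n : ℕ} (ζ : Fin n → curve P) : Matrix (Fin n) (Fin n) ℂ :=
  Matrix.of fun i j => evalAt (ζ j) (B i)

lemma bddAbove_vdm (hK : IsCompact K) (B : ℕ → CoordRing P) (n : ℕ) :
    BddAbove {x | ∃ ζ : Fin n → curve P, (∀ j, ζ j ∈ K) ∧ x = ‖(vdmMatrix B ζ).det‖} := by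
  refine ⟨n.factorial • (∑ i ∈ Finset.range n, normOn K (B i)) ^ n, ?_⟩
  rintro _ ⟨ζ, hζ, rfl⟩
  have := Matrix.det_le (A := vdmMatrix B ζ) (abv := NormedField.toAbsoluteValue ℂ)
    (x := ∑ i ∈ Finset.range n, normOn K (B i)) fun i j =>
      (norm_evalAt_le hK (B i) (hζ j)).trans
        (Finset.single_le_sum (f := fun i => normOn K (B i)) (fun i _ => normOn_nonneg _)
          (Finset.mem_range.2 i.2))
  rwa [Fintype.card_fin] at this

lemma norm_det_le_vdmSup (hK : IsCompact K) (B : ℕ → CoordRing P) {n : ℕ} {ζ : Fin n → curve P}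
    (hζ : ∀ j, ζ j ∈ K) : ‖(vdmMatrix B ζ).det‖ ≤ vdmSup K B n :=
  le_csSup (bddAbove_vdm hK B n) ⟨ζ, hζ, rfl⟩

lemma vdmSup_nonneg (B : ℕ → CoordRing P) (n : ℕ) : 0 ≤ vdmSup K B n :=
  Real.sSup_nonneg (by rintro _ ⟨ζ, -, rfl⟩; exact norm_nonneg _)

lemma vdmSup_le {n : ℕ} {c : ℝ} (hc : 0 ≤ c)
    (h : ∀ ζ : Fin n → curve P, (∀ j, ζ j ∈ K) → ‖(vdmMatrix B ζ).det‖ ≤ c) : vdmSup K B n ≤ c :=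
  Real.sSup_le (by rintro _ ⟨ζ, hζ, rfl⟩; exact h ζ hζ) hc

lemma vdmSup_zero (hK : IsCompact K) (B : ℕ → CoordRing P) : vdmSup K B 0 = 1 := by
  refine le_antisymm (vdmSup_le zero_le_one fun ζ _ => by simp) ?_
  simpa using norm_det_le_vdmSup hK B (ζ := Fin.elim0) (fun j => j.elim0)

/-- Laplace expansion along the last column: as a function of the last point, the determinant is a
combination of the `B i`, with the smaller determinant as coefficient of `B n`. -/
lemma exists_det_snoc_eq (B : ℕ → CoordRing P) {n : ℕ} (ζ : Fin n → curve P) :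
    ∃ r ∈ Submodule.span ℂ (B '' {i | i < n}), ∀ z,
      (vdmMatrix B (Fin.snoc ζ z : Fin (n + 1) → curve P)).det =
        evalAt z ((vdmMatrix B ζ).det • B n + r) := by
  refine ⟨∑ i : Fin n, ((-1) ^ (i + n : ℕ) *
    (Matrix.of fun a b : Fin n => evalAt (ζ b) (B (i.castSucc.succAbove a))).det) • B i,
    Submodule.sum_mem _ fun i _ => Submodule.smul_mem _ _ (Submodule.subset_span ⟨i, i.2, rfl⟩),
    fun z => ?_⟩
  rw [Matrix.det_succ_column _ (Fin.last n), Fin.sum_univ_castSucc, add_comm, map_add, map_sum]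
  congr 1
  · rw [evalAt_smul, mul_comm]
    have h1 : ((-1 : ℂ)) ^ (n + n) = 1 := Even.neg_one_pow ⟨n, rfl⟩
    have h2 : (vdmMatrix B (Fin.snoc ζ z : Fin (n + 1) → curve P)).submatrix
        (Fin.last n).succAbove (Fin.last n).succAbove = vdmMatrix B ζ := by
      ext a b
      simp [vdmMatrix]
    rw [h2]
    simp [vdmMatrix, h1]
  · refine Finset.sum_congr rfl fun i _ => ?_
    have h2 : (vdmMatrix B (Fin.snoc ζ z : Fin (n + 1) → curve P)).submatrix
        i.castSucc.succAbove (Fin.last n).succAbove =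
        Matrix.of fun a b : Fin n => evalAt (ζ b) (B (i.castSucc.succAbove a)) := by
      ext a b
      simp [vdmMatrix]
    rw [h2, evalAt_smul]
    simp [vdmMatrix]
    ring

lemma infNorm_mul_vdmSup_le (hK : IsCompact K) (B : ℕ → CoordRing P) (n : ℕ) :
    infNorm K (monicAt B n) * vdmSup K B n ≤ vdmSup K B (n + 1) := by
  rcases (infNorm_nonneg (K := K) (monicAt B n)).eq_or_lt with h0 | h0
  · rw [← h0, zero_mul]
    exact vdmSup_nonneg B _
  rw [mul_comm, ← le_div_iff₀ h0]
  refine vdmSup_le (div_nonneg (vdmSup_nonneg B _) h0.le) fun ζ hζ => ?_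
  rw [le_div_iff₀ h0]
  by_cases hdet : (vdmMatrix B ζ).det = 0
  · rw [hdet, norm_zero, zero_mul]
    exact vdmSup_nonneg B _
  obtain ⟨r, hr, h⟩ := exists_det_snoc_eq B ζ
  -- Normalized by the smaller determinant, the expansion competes for the extremal norm at position
  -- `n`. Arbitrary points suffice, so no maximizing configuration is needed.
  have hmem : (vdmMatrix B ζ).det⁻¹ • ((vdmMatrix B ζ).det • B n + r) ∈ monicAt B n :=
    ⟨(vdmMatrix B ζ).det⁻¹ • r, Submodule.smul_mem _ _ hr, by
      rw [smul_add, smul_smul, inv_mul_cancel₀ hdet, one_smul]⟩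
  have h1 := (infNorm_le (K := K) hmem).trans (normOn_smul_le hK _ _)
  rw [norm_inv, ← div_eq_inv_mul, le_div_iff₀ (norm_pos_iff.2 hdet), mul_comm] at h1
  refine h1.trans (normOn_le (vdmSup_nonneg B _) fun z hz => ?_)
  rw [← h z]
  refine norm_det_le_vdmSup hK B fun j => ?_
  refine Fin.lastCases ?_ (fun j => ?_) j
  · simpa using hz
  · simpa using hζ j

lemma det_updateRow_last_of_mem_span {n : ℕ} (ζ : Fin (n + 1) → curve P) {r : CoordRing P}
    (hr : r ∈ Submodule.span ℂ (B '' {i | i < n})) :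
    ((vdmMatrix B ζ).updateRow (Fin.last n) fun k => evalAt (ζ k) r).det = 0 := by
  induction hr using Submodule.span_induction with
  | zero => exact Matrix.det_eq_zero_of_row_eq_zero (Fin.last n) (by simp)
  | add x y _ _ hx hy =>
    have : (fun k => evalAt (ζ k) (x + y)) =
        (fun k => evalAt (ζ k) x) + fun k => evalAt (ζ k) y := by
      ext k; simp
    rw [this, Matrix.det_updateRow_add, hx, hy, add_zero]
  | smul a x _ hx =>
    have : (fun k => evalAt (ζ k) (a • x)) = a • fun k => evalAt (ζ k) x := by
      ext k; simp [evalAt_smul]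
    rw [this, Matrix.det_updateRow_smul, hx, mul_zero]
  | mem x hx =>
    obtain ⟨i, hi, rfl⟩ := hx
    exact Matrix.det_updateRow_eq_zero (M := vdmMatrix B ζ) (i := ⟨i, Nat.lt_succ_of_lt hi⟩)
      (Fin.ne_of_lt hi)

/-- Row operations replace the last row by the values of any monic competitor. Expanding along that
row gives `n + 1` minors, each at most `V_n`. -/
lemma vdmSup_succ_le (hK : IsCompact K) (B : ℕ → CoordRing P) (n : ℕ) :
    vdmSup K B (n + 1) ≤ (n + 1) * infNorm K (monicAt B n) * vdmSup K B n := by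
  rw [mul_assoc, mul_comm, mul_assoc]
  refine le_infNorm_mul (monicAt_nonempty B n)
    (mul_nonneg (vdmSup_nonneg B n) (by positivity)) fun f hf => ?_
  refine vdmSup_le (mul_nonneg (normOn_nonneg f)
    (mul_nonneg (vdmSup_nonneg B n) (by positivity))) fun ζ hζ => ?_
  obtain ⟨r, hr, rfl⟩ := hf
  have hrow : ((vdmMatrix B ζ).updateRow (Fin.last n) fun k => evalAt (ζ k) (B n + r)).det =
      (vdmMatrix B ζ).det := by
    have : (fun k => evalAt (ζ k) (B n + r)) =
        (fun k => evalAt (ζ k) (B n)) + fun k => evalAt (ζ k) r := by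
      ext k; simp
    rw [this, Matrix.det_updateRow_add, det_updateRow_last_of_mem_span ζ hr, add_zero]
    exact congrArg Matrix.det (Matrix.updateRow_eq_self (vdmMatrix B ζ) (Fin.last n))
  rw [← hrow, Matrix.det_succ_row _ (Fin.last n)]
  refine (norm_sum_le _ _).trans ?_
  calc _ ≤ ∑ _k : Fin (n + 1), normOn K (B n + r) * vdmSup K B n := by
        refine Finset.sum_le_sum fun k _ => ?_
        rw [norm_mul, norm_mul, norm_pow, norm_neg, norm_one, one_pow, one_mul,
          Matrix.updateRow_self]
        refine mul_le_mul (norm_evalAt_le hK _ (hζ k)) ?_ (norm_nonneg _) (normOn_nonneg _)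
        have : ((vdmMatrix B ζ).updateRow (Fin.last n) fun k => evalAt (ζ k) (B n + r)).submatrix
            (Fin.last n).succAbove k.succAbove = vdmMatrix B (ζ ∘ k.succAbove) := by
          ext a b
          simp [vdmMatrix]
        rw [this]
        exact norm_det_le_vdmSup hK B fun j => hζ _
    _ = _ := by simp; ring

/-! Sequences adapted to the degree filtration. -/

variable {u : ℕ → ℕ → Fin d → ℂ}

lemma LeadSystem.countDeg_eq (hB : LeadSystem lam B u) (hP : TopSplits P lam) (n : ℕ) :
    countDeg B n = gridStart d (n + 1) := by
  have hd : 0 < d := by have := hP.two_le; omega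
  have : {j | deg (B j) ≤ n} = ↑(Finset.range (gridStart d (n + 1))) := by
    ext j
    simp [hB.deg_eq hP, gridIndex_fst_le_iff hd]
  rw [countDeg, this, Set.ncard_coe_finset, Finset.card_range]

lemma LeadSystem.sumDeg_eq (hB : LeadSystem lam B u) (hP : TopSplits P lam) (n : ℕ) :
    sumDeg B n = gridWeight d (n + 1) := by
  rw [sumDeg, hB.countDeg_eq hP]
  generalize n + 1 = N
  induction N with
  | zero => simp [gridStart, gridWeight]
  | succ N ih =>
    rw [gridStart_succ, Finset.sum_range_add, ih, gridWeight, gridWeight, Finset.sum_range_succ]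
    congr 1
    rw [Finset.sum_congr rfl (g := fun _ => N) fun k hk => ?_]
    · simp [mul_comm]
    · rw [hB.deg_eq hP, gridIndex_gridStart_add (Finset.mem_range.1 hk)]

lemma LeadSystem.transDiam_eq (hB : LeadSystem lam B u) (hP : TopSplits P lam) (hK : IsCompact K)
    {T : Fin d → ℝ} (hT : ∀ k, 0 ≤ T k)
    (hlim : ∀ k : Fin d, Tendsto
      (fun n => infNorm K (monicAt B (gridStart d n + k)) ^ (1 / (n : ℝ))) atTop (𝓝 (T k)))
    (hpos : (∀ k, 0 < T k) → ∀ j, 0 < infNorm K (monicAt B j)) :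
    transDiam K B = (∏ k, T k) ^ (1 / (d : ℝ)) := by
  have hd : 0 < d := by have := hP.two_le; omega
  have := tendsto_root_of_grid hd (vdmSup_zero hK B) (vdmSup_nonneg B)
    (fun j => infNorm_nonneg _) hT (infNorm_mul_vdmSup_le hK B) (vdmSup_succ_le hK B) hlim hpos
  rw [transDiam]
  simp only [hB.countDeg_eq hP, hB.sumDeg_eq hP]
  exact this.limsup_eq

/-- This turns monicity with respect to a basis into a condition on leading vectors only, the form
in which both bases are compared with the directional classes. -/
lemma LeadSystem.mem_monicAt_iff (hB : LeadSystem lam B u) (hP : TopSplits P lam) {n k : ℕ}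
    (hk : k < min (n + 1) d) {f : CoordRing P} :
    f ∈ monicAt B (gridStart d n + k) ↔
      ∃ w ∈ Submodule.span ℂ (u n '' {i | i < k}), HasLead lam f n (u n k + w) := by
  constructor
  · rintro ⟨r, hr, rfl⟩
    obtain ⟨w, hw, hrw⟩ := hB.exists_lead_of_mem_span hP hk.le hr
    exact ⟨w, hw, (hB.hasLead n k hk).add hrw⟩
  · rintro ⟨w, hw, hf⟩
    have h1 := hf.sub (hB.hasLead n k hk)
    rw [add_sub_cancel_left] at h1
    exact ⟨_, hB.mem_span_of_lead hP hk.le h1 hw, (add_sub_cancel _ _).symm⟩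

end

section

variable {P : MvPolynomial (Fin 2) ℂ} {d : ℕ} {lam : Fin d → ℂ} {K : Set (curve P)}

/-! Comparison of the Chebyshev constants. -/

lemma mem_span_pow_iff (lam : Fin d → ℂ) (k : ℕ) (w : Fin d → ℂ) :
    w ∈ Submodule.span ℂ ((fun i => lam ^ i) '' {i | i < k}) ↔
      ∃ h : Polynomial ℂ, h.degree < k ∧ ∀ i, h.eval (lam i) = w i := by
  constructor
  · intro hw
    induction hw using Submodule.span_induction with
    | zero => exact ⟨0, by simp, by simp⟩
    | add x y _ _ hx hy =>
      obtain ⟨g, hg, hgx⟩ := hx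
      obtain ⟨h, hh, hhy⟩ := hy
      exact ⟨g + h, (Polynomial.degree_add_le _ _).trans_lt (max_lt hg hh), fun i => by
        simp [hgx, hhy]⟩
    | smul a x _ hx =>
      obtain ⟨g, hg, hgx⟩ := hx
      exact ⟨a • g, (Polynomial.degree_smul_le _ _).trans_lt hg, fun i => by simp [hgx]⟩
    | mem x hx =>
      obtain ⟨i, hi, rfl⟩ := hx
      exact ⟨Polynomial.X ^ i, by rw [Polynomial.degree_X_pow]; exact_mod_cast hi, by simp⟩
  · rintro ⟨h, hh, hw⟩
    have : w = ∑ i ∈ Finset.range k, h.coeff i • lam ^ i := by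
      ext j
      rw [← hw j]
      rcases eq_or_ne h 0 with rfl | h0
      · simp
      · rw [Polynomial.eval_eq_sum_range' ((Polynomial.natDegree_lt_iff_degree_lt h0).2 hh)]
        simp
    rw [this]
    exact Submodule.sum_mem _ fun i hi => Submodule.smul_mem _ _
      (Submodule.subset_span ⟨i, Finset.mem_range.1 hi, rfl⟩)

/-- Multiplication by `v_i` kills all coordinates of the leading vector except `v i`, at the cost of
raising the degree by `d - 1`. Dividing by `v i` gives a competitor in the directional class. -/
lemma norm_mul_infNorm_dirClass_le (hK : IsCompact K) (hinj : Function.Injective lam)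
    {f : CoordRing P} {n : ℕ} {v : Fin d → ℂ} (hf : HasLead lam f n v) (i : Fin d) :
    ‖v i‖ * infNorm K (dirClass P lam (n + (d - 1)) i) ≤
      normOn K f * normOn K (dirPoly P lam i) := by
  by_cases hi : v i = 0
  · rw [hi, norm_zero, zero_mul]
    exact mul_nonneg (normOn_nonneg _) (normOn_nonneg _)
  have h1 := (hf.mul (HasLead.dirPoly (P := P) hinj i)).smul (v i)⁻¹
  have h2 : (v i)⁻¹ • (v * Pi.single i 1) = Pi.single i (1 : ℂ) := by
    ext j
    by_cases hj : j = i
    · subst hj; simp [hi]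
    · simp [hj]
  rw [h2] at h1
  have h3 := (infNorm_le (K := K) (N := dirClass P lam (n + (d - 1)) i) h1).trans
    (normOn_smul_le hK _ _)
  rw [norm_inv, ← div_eq_inv_mul, le_div_iff₀ (norm_pos_iff.2 hi), mul_comm] at h3
  exact h3.trans (normOn_mul_le hK _ _)

/-- A monic polynomial of degree `k` cannot be small at all of `k + 1` given points. -/
lemma exists_norm_eval_ge (hinj : Function.Injective lam) (k : Fin d) :
    ∃ c : ℝ, 0 < c ∧ ∀ g : Polynomial ℂ, g.Monic → g.natDegree = k →
      ∃ i ≤ k, c ≤ ‖g.eval (lam i)‖ := by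
  set w : Fin d → ℂ := fun i => ∏ j ∈ (Finset.Iic k).erase i, (lam i - lam j) with hw
  have hw0 : ∀ i, w i ≠ 0 := fun i => Finset.prod_ne_zero_iff.2 fun j hj =>
    sub_ne_zero.2 (hinj.ne (Finset.ne_of_mem_erase hj).symm)
  have hS : 0 < ∑ i ∈ Finset.Iic k, ‖w i‖⁻¹ :=
    Finset.sum_pos (fun i _ => inv_pos.2 (norm_pos_iff.2 (hw0 i))) ⟨k, by simp⟩
  -- By Lagrange's formula the leading coefficient `1` equals `∑ g(lam i) / w i` over `i ≤ k`. If
  -- all values were below the inverse of `∑ ‖w i‖⁻¹`, this sum would have norm less than `1`.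
  refine ⟨(∑ i ∈ Finset.Iic k, ‖w i‖⁻¹)⁻¹, inv_pos.2 hS, fun g hg hgk => ?_⟩
  by_contra! hlt
  have hcard : ((Finset.Iic k).card : WithBot ℕ) = g.degree + 1 := by
    rw [Polynomial.degree_eq_natDegree hg.ne_zero, hgk, Fin.card_Iic]
    norm_cast
  have h1 := Lagrange.leadingCoeff_eq_sum (s := Finset.Iic k) (v := lam) hinj.injOn hcard
  rw [hg.leadingCoeff] at h1
  have h2 : (1 : ℝ) ≤ ∑ i ∈ Finset.Iic k, ‖g.eval (lam i)‖ * ‖w i‖⁻¹ := by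
    calc (1 : ℝ) = ‖(1 : ℂ)‖ := by simp
      _ ≤ ∑ i ∈ Finset.Iic k, ‖g.eval (lam i) / w i‖ := by rw [h1]; exact norm_sum_le _ _
      _ = _ := Finset.sum_congr rfl fun i _ => by rw [norm_div, div_eq_mul_inv]
  have h3 : ∑ i ∈ Finset.Iic k, ‖g.eval (lam i)‖ * ‖w i‖⁻¹ <
      ∑ i ∈ Finset.Iic k, (∑ i ∈ Finset.Iic k, ‖w i‖⁻¹)⁻¹ * ‖w i‖⁻¹ :=
    Finset.sum_lt_sum_of_nonempty ⟨k, by simp⟩ fun i hi =>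
      mul_lt_mul_of_pos_right (hlt i (Finset.mem_Iic.1 hi)) (inv_pos.2 (norm_pos_iff.2 (hw0 i)))
  rw [← Finset.mul_sum, inv_mul_cancel₀ hS.ne'] at h3
  linarith

lemma exists_norm_apply_ge (hinj : Function.Injective lam) (k : Fin d) :
    ∃ c : ℝ, 0 < c ∧ ∀ w ∈ Submodule.span ℂ ((fun i => lam ^ i) '' {i | i < (k : ℕ)}),
      ∃ i ≤ k, c ≤ ‖(lam ^ (k : ℕ) + w) i‖ := by
  obtain ⟨c, hc, hck⟩ := exists_norm_eval_ge hinj k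
  refine ⟨c, hc, fun w hw => ?_⟩
  obtain ⟨h, hh, hhw⟩ := (mem_span_pow_iff lam k w).1 hw
  have hdeg : (Polynomial.X ^ (k : ℕ) + h).degree = ((k : ℕ) : WithBot ℕ) := by
    rw [Polynomial.degree_add_eq_left_of_degree_lt (by rwa [Polynomial.degree_X_pow]),
      Polynomial.degree_X_pow]
  obtain ⟨i, hik, hi⟩ := hck _ (Polynomial.monic_X_pow_add hh)
    (Polynomial.natDegree_eq_of_degree_eq_some hdeg)
  exact ⟨i, hik, by simpa [hhw] using hi⟩

lemma exists_le_infNorm_monBasis (hK : IsCompact K) (hP : TopSplits P lam) (hne : ∀ k, lam k ≠ 0)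
    (k : Fin d) : ∃ c : ℝ, 0 < c ∧ ∀ n, (k : ℕ) ≤ n → ∃ i ≤ k,
      c * infNorm K (dirClass P lam (n + (d - 1)) i) ≤
        infNorm K (monicAt (monBasis P d) (gridStart d n + k)) := by
  obtain ⟨c, hc, hck⟩ := exists_norm_apply_ge hP.injective k
  set D : ℝ := 1 + ∑ i, normOn K (dirPoly P lam i) with hD
  have hD0 : 0 < D := by
    have : 0 ≤ ∑ i, normOn K (dirPoly P lam i) := Finset.sum_nonneg fun i _ => normOn_nonneg _
    linarith
  have hDi : ∀ i, normOn K (dirPoly P lam i) ≤ D := fun i => by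
    have := Finset.single_le_sum (f := fun i => normOn K (dirPoly P lam i))
      (fun i _ => normOn_nonneg _) (Finset.mem_univ i)
    linarith
  refine ⟨c / D, by positivity, fun n hn => ?_⟩
  -- The coordinate that is large depends on the competitor `f`. Taking the index with smallest
  -- extremal norm makes the choice depend on `n` alone.
  obtain ⟨i₀, hi₀, hmin⟩ := Finset.exists_min_image (Finset.Iic k)
    (fun i => infNorm K (dirClass P lam (n + (d - 1)) i)) ⟨k, by simp⟩
  refine ⟨i₀, Finset.mem_Iic.1 hi₀, le_infNorm (monicAt_nonempty _ _) fun f hf => ?_⟩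
  obtain ⟨w, hw, hfw⟩ := ((leadSystem_monBasis hP hne).mem_monicAt_iff hP
    (by have := k.2; omega)).1 hf
  obtain ⟨i, hik, hi⟩ := hck w hw
  have h1 := norm_mul_infNorm_dirClass_le hK hP.injective hfw i
  rw [div_mul_eq_mul_div, div_le_iff₀ hD0]
  calc c * infNorm K (dirClass P lam (n + (d - 1)) i₀)
      ≤ ‖(lam ^ (k : ℕ) + w) i‖ * infNorm K (dirClass P lam (n + (d - 1)) i) :=
        mul_le_mul hi (hmin i (Finset.mem_Iic.2 hik)) (infNorm_nonneg _) (norm_nonneg _)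
    _ ≤ normOn K f * normOn K (dirPoly P lam i) := h1
    _ ≤ normOn K f * D := mul_le_mul_of_nonneg_left (hDi i) (normOn_nonneg _)

lemma exists_infNorm_monBasis_le (hK : IsCompact K) (hP : TopSplits P lam) (hne : ∀ k, lam k ≠ 0)
    (k : Fin d) : ∃ C : ℝ, 0 < C ∧ ∀ n, d - 1 ≤ n → ∃ i, k ≤ i ∧
      infNorm K (monicAt (monBasis P d) (gridStart d n + k)) ≤
        C * infNorm K (dirClass P lam n i) := by
  -- This monic choice annihilates the directions `i < k`, so a competitor can be assembled from
  -- near-extremal elements in the directions `i ≥ k` with weights `g(lam i)`.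
  set g : Polynomial ℂ := ∏ i ∈ Finset.Iio k, (Polynomial.X - Polynomial.C (lam i)) with hg
  have hgm : g.Monic := Polynomial.monic_prod_X_sub_C _ _
  have hgd : g.natDegree = k := by simp [hg]
  set S : ℝ := ∑ i ∈ Finset.Ici k, ‖g.eval (lam i)‖ with hS
  have hS0 : 0 ≤ S := Finset.sum_nonneg fun i _ => norm_nonneg _
  -- If the bound failed for all `i ≥ k`, the assembled competitor would give `t ≤ S * t / (1 + S)`
  -- with `t > 0`. The summand `1` makes this contradictory.
  refine ⟨1 + S, by positivity, fun n hn => ?_⟩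
  by_contra! hlt
  set t := infNorm K (monicAt (monBasis P d) (gridStart d n + k)) with ht
  have ht0 : 0 < t := (mul_nonneg (by positivity) (infNorm_nonneg _)).trans_lt (hlt k le_rfl)
  have hex : ∀ i, ∃ f, HasLead lam f n (Pi.single i 1) ∧ (k ≤ i → normOn K f < t / (1 + S)) := by
    intro i
    by_cases hi : k ≤ i
    · obtain ⟨f, hf, hft⟩ := exists_normOn_lt (K := K) (dirClass_nonempty hP.injective hn i)
        ((lt_div_iff₀' (by positivity)).2 (hlt i hi))
      exact ⟨f, hf, fun _ => hft⟩
    · obtain ⟨f, hf⟩ := dirClass_nonempty (P := P) hP.injective hn i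
      exact ⟨f, hf, fun h => absurd h hi⟩
  choose f hf hft using hex
  have hlead := HasLead.sum (Finset.Ici k) fun i _ => (hf i).smul (g.eval (lam i))
  have hv : ∑ i ∈ Finset.Ici k, g.eval (lam i) • (Pi.single i 1 : Fin d → ℂ) =
      lam ^ (k : ℕ) + (fun i => (g - Polynomial.X ^ (k : ℕ)).eval (lam i)) := by
    ext j
    have h1 : (∑ i ∈ Finset.Ici k, g.eval (lam i) • (Pi.single i 1 : Fin d → ℂ)) j =
        if k ≤ j then g.eval (lam j) else 0 := by
      simp [Finset.sum_apply, Pi.single_apply]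
    rw [h1]
    split_ifs with hj
    · simp
    · have h2 : g.eval (lam j) = 0 := by
        rw [hg, Polynomial.eval_prod]
        exact Finset.prod_eq_zero (Finset.mem_Iio.2 (not_le.1 hj)) (by simp)
      simp [h2]
  have hmem : ∑ i ∈ Finset.Ici k, g.eval (lam i) • f i ∈
      monicAt (monBasis P d) (gridStart d n + k) := by
    refine ((leadSystem_monBasis hP hne).mem_monicAt_iff hP (by have := k.2; omega)).2
      ⟨_, (mem_span_pow_iff lam k _).2 ⟨g - Polynomial.X ^ (k : ℕ), ?_, fun i => rfl⟩, hv ▸ hlead⟩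
    have hgd' : g.degree = (k : ℕ) := by rw [Polynomial.degree_eq_natDegree hgm.ne_zero, hgd]
    rw [← hgd']
    exact Polynomial.degree_sub_lt_left (by rw [hgd', Polynomial.degree_X_pow]) hgm.ne_zero
      (by rw [hgm.leadingCoeff, Polynomial.leadingCoeff_X_pow])
  have h3 : t ≤ S * (t / (1 + S)) := by
    calc t ≤ ∑ i ∈ Finset.Ici k, normOn K (g.eval (lam i) • f i) :=
          (infNorm_le hmem).trans (normOn_sum_le hK _ _)
      _ ≤ ∑ i ∈ Finset.Ici k, ‖g.eval (lam i)‖ * (t / (1 + S)) :=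
          Finset.sum_le_sum fun i hi => (normOn_smul_le hK _ _).trans
            (mul_le_mul_of_nonneg_left (hft i (Finset.mem_Ici.1 hi)).le (norm_nonneg _))
      _ = S * (t / (1 + S)) := (Finset.sum_mul _ _ _).symm
  rw [mul_div_assoc', le_div_iff₀ (by positivity)] at h3
  linarith

lemma dirBasis_eq_monBasis {n k : ℕ} (hk : k < min (n + 1) d) (hn : n < d - 1) :
    dirBasis P lam (gridStart d n + k) = monBasis P d (gridStart d n + k) := by
  rw [dirBasis, gridIndex_gridStart_add hk, if_pos hn]

lemma monicAt_dirBasis_eq {n k : ℕ} (hk : k < min (n + 1) d) (hn : n < d - 1) :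
    monicAt (dirBasis P lam) (gridStart d n + k) = monicAt (monBasis P d) (gridStart d n + k) := by
  have : dirBasis P lam '' {i | i < gridStart d n + k} = monBasis P d '' {i | i < gridStart d n + k} := by
    refine Set.image_congr fun i hi => ?_
    rw [Set.mem_ofPred_eq] at hi
    obtain ⟨n', k', hk', rfl⟩ := exists_eq_gridStart_add (by omega : 0 < d) i
    refine dirBasis_eq_monBasis hk' ?_
    by_contra hlt
    have := gridStart_mono d (show n + 1 ≤ n' by omega)
    rw [gridStart_succ] at this
    omega
  rw [monicAt, monicAt, this, dirBasis_eq_monBasis hk hn]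

/-- The preceding elements of the same degree have leading vectors `e_i` with `i < k`, so the `k`-th
coordinate of every competitor's leading vector is exactly `1`. No interpolation or ordering of the
directions is involved. -/
lemma exists_le_infNorm_dirBasis (hK : IsCompact K) (hP : TopSplits P lam) (hne : ∀ k, lam k ≠ 0)
    (k : Fin d) : ∃ c : ℝ, 0 < c ∧ ∀ n, d - 1 ≤ n →
      c * infNorm K (dirClass P lam (n + (d - 1)) k) ≤
        infNorm K (monicAt (dirBasis P lam) (gridStart d n + k)) := by
  have hD : 0 < 1 + normOn K (dirPoly P lam k) := by
    have := normOn_nonneg (K := K) (dirPoly P lam k)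
    linarith
  refine ⟨(1 + normOn K (dirPoly P lam k))⁻¹, inv_pos.2 hD, fun n hn => ?_⟩
  refine le_infNorm (monicAt_nonempty _ _) fun f hf => ?_
  obtain ⟨w, hw, hfw⟩ := ((leadSystem_dirBasis hP hne).mem_monicAt_iff hP
    (by have := k.2; omega)).1 hf
  have hwk : w k = 0 := by
    have hle : Submodule.span ℂ (dirLead lam n '' {i | i < (k : ℕ)}) ≤
        LinearMap.ker (LinearMap.proj k : (Fin d → ℂ) →ₗ[ℂ] ℂ) := by
      rw [Submodule.span_le]
      rintro _ ⟨i, hi, rfl⟩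
      rw [Set.mem_ofPred_eq] at hi
      have hne' : k ≠ ⟨i, hi.trans k.2⟩ := fun h => by
        have := congrArg Fin.val h
        simp only at this
        omega
      simp [dirLead, not_lt.2 hn, hi.trans k.2, hne']
    exact hle hw
  have h1 := norm_mul_infNorm_dirClass_le hK hP.injective hfw k
  have h2 : (dirLead lam n k + w) k = 1 := by simp [dirLead, not_lt.2 hn, hwk]
  rw [h2, norm_one, one_mul] at h1
  rw [inv_mul_le_iff₀ hD, mul_comm]
  exact h1.trans (mul_le_mul_of_nonneg_left (by linarith) (normOn_nonneg _))

lemma infNorm_dirBasis_le (hP : TopSplits P lam) (hne : ∀ k, lam k ≠ 0)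
    (k : Fin d) {n : ℕ} (hn : d - 1 ≤ n) :
    infNorm K (monicAt (dirBasis P lam) (gridStart d n + k)) ≤
      infNorm K (dirClass P lam n k) := by
  refine le_infNorm (dirClass_nonempty hP.injective hn k) fun f hf => infNorm_le ?_
  refine ((leadSystem_dirBasis hP hne).mem_monicAt_iff hP (by have := k.2; omega)).2
    ⟨0, zero_mem _, ?_⟩
  have : dirLead lam n k = Pi.single k 1 := by simp [dirLead, not_lt.2 hn]
  rw [this, add_zero]
  exact hf

/-! Root asymptotics. -/

section

variable {T : Fin d → ℝ}

/-- The lower bound involves indices `i ≤ k`, where `T i ≥ T k`, and the upper one indices `i ≥ k`,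
where `T i ≤ T k`. This is the only place where the labelling of the directions enters. -/
lemma tendsto_infNorm_monBasis (hK : IsCompact K) (hP : TopSplits P lam) (hne : ∀ k, lam k ≠ 0)
    (hT : ∀ i, Tendsto (fun n : ℕ => infNorm K (dirClass P lam n i) ^ (1 / (n : ℝ))) atTop
      (𝓝 (T i))) (hanti : Antitone T) (k : Fin d) :
    Tendsto (fun n => infNorm K (monicAt (monBasis P d) (gridStart d n + k)) ^ (1 / (n : ℝ))) atTop
      (𝓝 (T k)) := by
  obtain ⟨c, hc, hlow⟩ := exists_le_infNorm_monBasis hK hP hne k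
  obtain ⟨C, hC, hup⟩ := exists_infNorm_monBasis_le hK hP hne k
  refine tendsto_root_of_exists_le (p := fun i => i ≤ k) (q := fun i => k ≤ i)
    (x := fun i n => c * infNorm K (dirClass P lam (n + (d - 1)) i))
    (y := fun i n => C * infNorm K (dirClass P lam n i))
    (fun n => infNorm_nonneg _) (fun i n => mul_nonneg hc.le (infNorm_nonneg _))
    (fun i => tendsto_shift_root (fun n => infNorm_nonneg _) hc (hT i) (d - 1))
    (fun i => tendsto_shift_root (fun n => infNorm_nonneg _) hC (hT i) 0)
    (fun i hi => hanti hi) (fun i hi => hanti hi) ?_ ?_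
  · filter_upwards [eventually_ge_atTop (k : ℕ)] with n hn using hlow n hn
  · filter_upwards [eventually_ge_atTop (d - 1)] with n hn using hup n hn

lemma tendsto_infNorm_dirBasis (hK : IsCompact K) (hP : TopSplits P lam) (hne : ∀ k, lam k ≠ 0)
    (hT : ∀ i, Tendsto (fun n : ℕ => infNorm K (dirClass P lam n i) ^ (1 / (n : ℝ))) atTop
      (𝓝 (T i))) (k : Fin d) :
    Tendsto (fun n => infNorm K (monicAt (dirBasis P lam) (gridStart d n + k)) ^ (1 / (n : ℝ)))
      atTop (𝓝 (T k)) := by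
  obtain ⟨c, hc, hlow⟩ := exists_le_infNorm_dirBasis hK hP hne k
  refine tendsto_of_tendsto_of_tendsto_of_le_of_le'
    (tendsto_shift_root (fun n => infNorm_nonneg _) hc (hT k) (d - 1)) (hT k) ?_ ?_
  · filter_upwards [eventually_ge_atTop (d - 1)] with n hn
    exact Real.rpow_le_rpow (mul_nonneg hc.le (infNorm_nonneg _)) (hlow n hn) (by positivity)
  · filter_upwards [eventually_ge_atTop (d - 1)] with n hn
    exact Real.rpow_le_rpow (infNorm_nonneg _) (infNorm_dirBasis_le hP hne k hn) (by positivity)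

lemma infNorm_monBasis_pos (hK : IsCompact K) (hP : TopSplits P lam) (hne : ∀ k, lam k ≠ 0)
    (hT : ∀ i, Tendsto (fun n : ℕ => infNorm K (dirClass P lam n i) ^ (1 / (n : ℝ))) atTop
      (𝓝 (T i))) (hpos : ∀ k, 0 < T k) (j : ℕ) : 0 < infNorm K (monicAt (monBasis P d) j) := by
  obtain ⟨n, k, hk, rfl⟩ := exists_eq_gridStart_add (by have := hP.two_le; omega : 0 < d) j
  obtain ⟨c, hc, hlow⟩ := exists_le_infNorm_monBasis hK hP hne ⟨k, by omega⟩
  obtain ⟨i, -, hi⟩ := hlow n (by simp only; omega)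
  exact (mul_pos hc (infNorm_dirClass_pos hK hP.injective (hpos i) (hT i) (by omega))).trans_le hi

lemma infNorm_dirBasis_pos (hK : IsCompact K) (hP : TopSplits P lam) (hne : ∀ k, lam k ≠ 0)
    (hT : ∀ i, Tendsto (fun n : ℕ => infNorm K (dirClass P lam n i) ^ (1 / (n : ℝ))) atTop
      (𝓝 (T i))) (hpos : ∀ k, 0 < T k) (j : ℕ) : 0 < infNorm K (monicAt (dirBasis P lam) j) := by
  obtain ⟨n, k, hk, rfl⟩ := exists_eq_gridStart_add (by have := hP.two_le; omega : 0 < d) j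
  by_cases hn : n < d - 1
  · rw [monicAt_dirBasis_eq hk hn]
    exact infNorm_monBasis_pos hK hP hne hT hpos _
  · obtain ⟨c, hc, hlow⟩ := exists_le_infNorm_dirBasis hK hP hne ⟨k, by omega⟩
    exact (mul_pos hc (infNorm_dirClass_pos hK hP.injective (hpos _) (hT _) (by omega))).trans_le
      (hlow n (not_lt.1 hn))

/-! The Chebyshev constants of the classes of the statement. -/

lemma hasCheb_of_tendsto {N : Set (CoordRing P)} {T : ℝ} (hN : (degFilter N).NeBot)
    (h : Tendsto (chebN K N) (degFilter N) (𝓝 T)) : HasCheb K N ∧ cheb K N = T := by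
  have : cheb K N = T := h.limsup_eq
  exact ⟨⟨hN, this ▸ h⟩, this⟩

lemma degFilter_neBot {N : Set (CoordRing P)} (h : ∀ m, ∃ n ≥ m, n ∈ deg '' N) :
    (degFilter N).NeBot := by
  rw [degFilter, ← frequently_mem_iff_neBot, frequently_atTop]
  exact h

/-- Degree `0` has to be excluded: it comes from the exponent `0`, whose element `1` has the
all-ones leading vector instead of `e_i`. -/
lemma monicClass_deg_eq (hP : TopSplits P lam) (i : Fin d) {n : ℕ}
    (hn : n ∈ deg '' monicClass (dirPoly P lam i)) (hn0 : n ≠ 0) :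
    d - 1 ≤ n ∧ {p | p ∈ monicClass (dirPoly P lam i) ∧ deg p = n} = dirClass P lam n i := by
  have hsingle : (Pi.single i 1 : Fin d → ℂ) ≠ 0 := fun h => by simpa using congrFun h i
  have hlead : ∀ p ∈ monicClass (dirPoly P lam i), deg p = n →
      ∃ q, q ≠ 0 ∧ n = q * (d - 1) ∧ p ∈ dirClass P lam n i := by
    rintro p hp rfl
    rcases hasLead_of_mem_monicClass hP.injective hP hp with rfl | ⟨q, hq, hlead⟩
    · have := (HasLead.one (P := P) (lam := lam)).deg_le
      omega
    · have hdeg := hlead.deg_eq hP hsingle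
      exact ⟨q, hq, hdeg, hdeg ▸ hlead⟩
  obtain ⟨p₀, hp₀, hdeg₀⟩ := hn
  obtain ⟨q, hq, hqn, -⟩ := hlead p₀ hp₀ hdeg₀
  refine ⟨hqn ▸ Nat.le_mul_of_pos_left _ (Nat.pos_of_ne_zero hq), ?_⟩
  ext p
  constructor
  · rintro ⟨hp, hdeg⟩
    obtain ⟨-, -, -, h⟩ := hlead p hp hdeg
    exact h
  · intro hp
    have hv := (HasLead.dirPoly (P := P) hP.injective i).pow q
    rw [single_one_pow i hq] at hv
    refine ⟨⟨q, p - dirPoly P lam i ^ q, ?_, (add_sub_cancel _ _).symm⟩,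
      HasLead.deg_eq hP hp hsingle⟩
    rw [hv.deg_eq hP hsingle, ← hqn]
    rw [← hqn] at hv
    have := HasLead.sub hp hv
    rw [sub_self] at this
    exact this.isLot hP

lemma cheb_monicClass (hP : TopSplits P lam) {i : Fin d} {T : ℝ}
    (hT : Tendsto (fun n : ℕ => infNorm K (dirClass P lam n i) ^ (1 / (n : ℝ))) atTop (𝓝 T)) :
    HasCheb K (monicClass (dirPoly P lam i)) ∧ cheb K (monicClass (dirPoly P lam i)) = T := by
  refine hasCheb_of_tendsto (degFilter_neBot fun m => ?_) ?_
  · have hd := hP.two_le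
    refine ⟨(m + 1) * (d - 1), ?_, dirPoly P lam i ^ (m + 1), ⟨m + 1, 0, Or.inl rfl, by simp⟩, ?_⟩
    · exact (Nat.le_succ m).trans (Nat.le_mul_of_pos_right _ (by omega))
    · have hv := (HasLead.dirPoly (P := P) hP.injective i).pow (m + 1)
      rw [single_one_pow i (Nat.succ_ne_zero m)] at hv
      exact hv.deg_eq hP fun h => by simpa using congrFun h i
  · refine (hT.mono_left inf_le_left).congr' ?_
    have h1 : ∀ᶠ n in degFilter (monicClass (dirPoly P lam i)), n ≠ 0 :=
      (eventually_ne_atTop 0).filter_mono inf_le_left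
    have h2 : ∀ᶠ n in degFilter (monicClass (dirPoly P lam i)),
        n ∈ deg '' monicClass (dirPoly P lam i) :=
      mem_inf_of_right (mem_principal_self _)
    filter_upwards [h1, h2] with n hn0 hn
    rw [chebN, (monicClass_deg_eq hP i hn hn0).2, infNorm]

/-- Lower order terms in the sense of the basis order may have the same degree `n`. They cannot
lower the degree, because the values of a monic polynomial of degree `k` do not vanish at all `lam
i` with `i ≤ k`. -/
lemma zClass_deg_eq (hP : TopSplits P lam) (hne : ∀ k, lam k ≠ 0) (k : Fin d) {n : ℕ}
    (hn : (k : ℕ) ≤ n) :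
    {p | p ∈ zClass P d k ∧ deg p = n} = monicAt (monBasis P d) (gridStart d n + k) := by
  have hk := k.2
  have key : ∀ m, (k : ℕ) ≤ m → monBasis P d (gridStart d m + k) = z₂ P ^ (k : ℕ) * z₁ P ^ (m - k) := by
    intro m hm
    rw [monBasis, gridIndex_gridStart_add (by omega), mul_comm]
  have hdeg : ∀ m, (k : ℕ) ≤ m → ∀ p ∈ monicAt (monBasis P d) (gridStart d m + k), deg p = m := by
    intro m hm p hp
    obtain ⟨w, hw, hlead⟩ := ((leadSystem_monBasis hP hne).mem_monicAt_iff hP (by omega)).1 hp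
    refine hlead.deg_eq hP fun h0 => ?_
    obtain ⟨c, hc, hck⟩ := exists_norm_apply_ge hP.injective k
    obtain ⟨i, -, hi⟩ := hck w hw
    rw [show (lam ^ (k : ℕ) + w) i = 0 from congrFun h0 i, norm_zero] at hi
    linarith
  ext p
  constructor
  · rintro ⟨⟨m, j, hj, r, hr, rfl⟩, hp⟩
    obtain ⟨-, hj2⟩ := gridIndex_spec (by omega : 0 < d) j
    rw [hj] at hj2
    simp only at hj2
    subst hj2
    have hmem : z₂ P ^ (k : ℕ) * z₁ P ^ m + r ∈ monicAt (monBasis P d) (gridStart d (m + k) + k) :=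
      ⟨r, hr, by rw [key _ (by omega), Nat.add_sub_cancel]⟩
    rw [hdeg _ (by omega) _ hmem] at hp
    rwa [hp] at hmem
  · intro hp
    refine ⟨?_, hdeg n hn p hp⟩
    obtain ⟨r, hr, rfl⟩ := hp
    exact ⟨n - k, _, by rw [Nat.sub_add_cancel hn, gridIndex_gridStart_add (by omega)], r, hr,
      by rw [key n hn]⟩

lemma cheb_zClass (hP : TopSplits P lam) (hne : ∀ k, lam k ≠ 0) {k : Fin d} {T : ℝ}
    (hT : Tendsto (fun n : ℕ => infNorm K (monicAt (monBasis P d) (gridStart d n + k)) ^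
      (1 / (n : ℝ))) atTop (𝓝 T)) :
    HasCheb K (zClass P d k) ∧ cheb K (zClass P d k) = T := by
  refine hasCheb_of_tendsto (degFilter_neBot fun m => ?_) ?_
  · obtain ⟨p, hp⟩ := monicAt_nonempty (monBasis P d) (gridStart d (m + k) + k)
    rw [← zClass_deg_eq hP hne k (Nat.le_add_left _ _)] at hp
    exact ⟨m + k, Nat.le_add_right _ _, p, hp.1, hp.2⟩
  · refine (hT.mono_left inf_le_left).congr' ?_
    have h1 : ∀ᶠ n in degFilter (zClass P d k), (k : ℕ) ≤ n :=
      (eventually_ge_atTop (k : ℕ)).filter_mono inf_le_left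
    filter_upwards [h1] with n hn
    rw [chebN, zClass_deg_eq hP hne k hn, infNorm]

end

end

end AlgCurve

end

/-! ### The theorem. -/

theorem mainTheorem4 (P : MvPolynomial (Fin 2) ℂ) (hP : Irreducible P)
    (d : ℕ) (hd : 2 ≤ d) (hdeg : P.totalDegree = d)
    (lam c : Fin d → ℂ) (hinj : Function.Injective lam) (hne : ∀ k, lam k ≠ 0)
    (hasym : ∀ k, AlgCurve.IsLinearAsymptote (AlgCurve.curve P) (lam k) (c k))
    (K : Set (AlgCurve.curve P)) (hK : IsCompact K)
    (hord : Antitone fun k : Fin d => AlgCurve.dirCheb K lam k) :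
    (∀ k : Fin d, AlgCurve.HasCheb K (AlgCurve.monicClass (AlgCurve.dirPoly P lam k))) ∧
    (∀ k : Fin d, AlgCurve.HasCheb K (AlgCurve.zClass P d k)) ∧
    (∏ k : Fin d, AlgCurve.cheb K (AlgCurve.zClass P d k)) ^ (1 / (d : ℝ)) =
      AlgCurve.transDiam K (AlgCurve.monBasis P d) ∧
    AlgCurve.transDiam K (AlgCurve.monBasis P d) =
      AlgCurve.transDiam K (AlgCurve.dirBasis P lam) ∧
    AlgCurve.transDiam K (AlgCurve.dirBasis P lam) =
      (∏ k : Fin d, AlgCurve.dirCheb K lam k) ^ (1 / (d : ℝ)) ∧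
    (∀ k : Fin d, AlgCurve.cheb K (AlgCurve.zClass P d k) = AlgCurve.dirCheb K lam k) := by
  have hS := AlgCurve.topSplits_of_asymptotes hd hdeg hinj hasym
  choose T hT0 hT using fun i => AlgCurve.exists_tendsto_infNorm_dirClass (P := P) hK hinj hd i
  have hM := fun i => AlgCurve.cheb_monicClass hS (hT i)
  have hdir : ∀ k, AlgCurve.dirCheb K lam k = T k := fun k => (hM k).2
  have hanti : Antitone T := by simpa only [hdir] using hord
  have hmon := AlgCurve.tendsto_infNorm_monBasis hK hS hne hT hanti
  have hZ := fun k => AlgCurve.cheb_zClass hS hne (hmon k)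
  have hdS := (AlgCurve.leadSystem_monBasis hS hne).transDiam_eq hS hK hT0 hmon
    (AlgCurve.infNorm_monBasis_pos hK hS hne hT)
  have hdC := (AlgCurve.leadSystem_dirBasis hS hne).transDiam_eq hS hK hT0
    (AlgCurve.tendsto_infNorm_dirBasis hK hS hne hT) (AlgCurve.infNorm_dirBasis_pos hK hS hne hT)
  refine ⟨fun k => (hM k).1, fun k => (hZ k).1, ?_, hdS.trans hdC.symm, ?_, fun k => ?_⟩
  · simp only [(hZ _).2, hdS]
  · simp only [hdir, hdC]
  · rw [(hZ k).2, hdir]
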